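/- Let $d\ge 1$, $T>0$, $\lambda\in(0,2)$, $c_\lambda>0$, and $Q_T=\mathbb{R}^d\times(0,T)$. Let $f:\mathbb{R}\to\mathbb{R}^d$ and $A:\mathbb{R}\to\mathbb{R}$ be Lipschitz continuous, with $A$ non-decreasing and $A(0)=0$. Consider the Cauchy problem $$\partial_t u+\nabla\cdot f(u)=-(-\Delta)^{\lambda/2}A(u)\ \text{ in } Q_T,\qquad u(x,0)=u_0(x)\ \text{ in }\mathbb{R}^d, \qquad (1)$$ where $-(-\Delta)^{\lambda/2}\phi(x)=c_\lambda\,\mathrm{P.V.}\int_{|z|>0}\frac{\phi(x+z)-\phi(x)}{|z|^{d+\lambda}}\,dz$. For $r>0$ put $$g_r[\varphi](x)=c_\lambda\lim_{b\to0^+}\int_{b<|z|<r}\frac{\varphi(x+z)-\varphi(x)}{|z|^{d+\lambda}}\,dz,\qquad g^r[\varphi](x)=c_\lambda\int_{|z|>r}\frac{\varphi(x+z)-\varphi(x)}{|z|^{d+\lambda}}\,dz,$$ and for $k\in\mathbb{R}$ let $\eta_k(u)=|u-k|$, $\eta_k'(u)=\operatorname{sgn}(u-k)$ (with $\operatorname{sgn}(0)=0$)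 and $q_k(u)=\eta_k'(u)(f(u)-f(k))$. A function $u$ is called an entropy solution of (1) if (i) $u\in L^\infty(Q_T)\cap C([0,T];L^1(\mathbb{R}^d))$; (ii) for all $k\in\mathbb{R}$, all $r>0$ and all nonnegative $\varphi\in C_c^\infty(Q_T)$, $$\iint_{Q_T}\eta_k(u)\,\partial_t\varphi+q_k(u)\cdot\nabla\varphi+\eta_{A(k)}(A(u))\,g_r[\varphi]+\eta_k'(u)\,g^r[A(u)]\,\varphi\;dx\,dt\ \ge 0,$$ where $\nabla$, $g_r$ and $g^r$ act in the variable $x$; (iii) $u(\cdot,0)=u_0$ a.e. in $\mathbb{R}^d$. Then the following hold. ($L^1$-contraction) If $u$ and $v$ are entropy solutions of (1) with initial data $u_0$ and $v_0$ respectively, then for all $t\in(0,T)$, $$\|u(\cdot,t)-v(\cdot,t)\|_{L^1(\mathbb{R}^d)}\le\|u_0-v_0\|_{L^1(\mathbb{R}^d)}.$$ (Uniqueness) For given initial data $u_0$ there is at most one entropy solution of (1): if $u$ and $v$ are entropy solutions with the same initial data $u_0$, then $u=v$ a.e. on $Q_T$, and $u(\cdot,t)=v(\cdot,t)$ a.e.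 in $\mathbb{R}^d$ for every $t\in[0,T]$. -/

import Mathlib

open MeasureTheory Filter Topology Set
open scoped NNReal ENNReal ContDiff

noncomputable section

namespace FracConvDiff

/-- Euclidean space `ℝ^d`. -/
abbrev Space (d : ℕ) : Type := EuclideanSpace ℝ (Fin d)

/-- The space-time cylinder `Q_T = ℝ^d × (0,T)`. -/
def cylinder (d : ℕ) (T : ℝ) : Set (Space d × ℝ) := univ ×ˢ Ioo 0 T

/-- The singular part of the fractional Laplacian,
`g_r[φ](x) = c P.V. ∫_{|z|<r} (φ(x+z) - φ(x)) / |z|^(d+λ) dz`,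
the principal value being the limit of the integrals over `b < |z| < r` as `b → 0+`. -/
def gInner {d : ℕ} (c lam r : ℝ) (φ : Space d → ℝ) (x : Space d) : ℝ :=
  c * limUnder (𝓝[>] (0 : ℝ)) fun b : ℝ =>
    ∫ z in {z : Space d | b < ‖z‖ ∧ ‖z‖ < r}, (φ (x + z) - φ x) / ‖z‖ ^ ((d : ℝ) + lam)

/-- The regular part of the fractional Laplacian,
`g^r[φ](x) = c ∫_{|z|>r} (φ(x+z) - φ(x)) / |z|^(d+λ) dz`. -/
def gOuter {d : ℕ} (c lam r : ℝ) (φ : Space d → ℝ) (x : Space d) : ℝ :=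
  c * ∫ z in {z : Space d | r < ‖z‖}, (φ (x + z) - φ x) / ‖z‖ ^ ((d : ℝ) + lam)

/-- The Kružkov entropy `η_k(u) = |u - k|`. -/
def eta (k u : ℝ) : ℝ := |u - k|

/-- The derivative of the Kružkov entropy, `η'_k(u) = sgn(u - k)` with `sgn 0 = 0`. -/
def eta' (k u : ℝ) : ℝ := Real.sign (u - k)

/-- The entropy flux `q_k(u) = η'_k(u) (f(u) - f(k))`. -/
def flux {d : ℕ} (f : ℝ → Space d) (k u : ℝ) : Space d := eta' k u • (f u - f k)

/-- Nonnegative test functions `φ ∈ C_c^∞(Q_T)`, extended by zero to `ℝ^d × ℝ`. -/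
structure IsNonnegTest {d : ℕ} (T : ℝ) (φ : Space d × ℝ → ℝ) : Prop where
  smooth : ContDiff ℝ ∞ φ
  compact : HasCompactSupport φ
  support_subset : tsupport φ ⊆ cylinder d T
  nonneg : ∀ p, 0 ≤ φ p

/-- The function `u(x,t)` belongs to `C([0,T]; L^1(ℝ^d))`. -/
def MemCL1 {d : ℕ} (T : ℝ) (u : Space d → ℝ → ℝ) : Prop :=
  (∀ t ∈ Icc 0 T, MemLp (fun x => u x t) 1 volume) ∧
  ∀ t ∈ Icc 0 T,
    Tendsto (fun s => eLpNorm (fun x => u x s - u x t) 1 volume) (𝓝[Icc 0 T] t) (𝓝 0)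

/-- The integrand of the entropy inequality at the point `(x,t)`. -/
def entropyIntegrand {d : ℕ} (c lam : ℝ) (f : ℝ → Space d) (A : ℝ → ℝ)
    (u : Space d → ℝ → ℝ) (k r : ℝ) (φ : Space d × ℝ → ℝ) (x : Space d) (t : ℝ) : ℝ :=
  eta k (u x t) * deriv (fun s => φ (x, s)) t
    + inner ℝ (flux f k (u x t)) (gradient (fun y => φ (y, t)) x)
    + eta (A k) (A (u x t)) * gInner c lam r (fun y => φ (y, t)) x
    + eta' k (u x t) * gOuter c lam r (fun y => A (u y t)) x * φ (x, t)

/-- `u` is an entropy solution of `∂ₜu + ∇·f(u) = -(-Δ)^(λ/2) A(u)` in `Q_T` with initial datum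
`u₀`, where `c` is the constant in the definition of the fractional Laplacian. -/
structure IsEntropySolution {d : ℕ} (c lam T : ℝ) (f : ℝ → Space d) (A : ℝ → ℝ)
    (u₀ : Space d → ℝ) (u : Space d → ℝ → ℝ) : Prop where
  memLinfty : MemLp (fun p : Space d × ℝ => u p.1 p.2) ∞ (volume.restrict (cylinder d T))
  memCL1 : MemCL1 T u
  entropy_ineq : ∀ k r : ℝ, 0 < r → ∀ φ : Space d × ℝ → ℝ, IsNonnegTest T φ →
    0 ≤ ∫ p in cylinder d T, entropyIntegrand c lam f A u k r φ p.1 p.2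
  initial : ∀ᵐ x, u x 0 = u₀ x

end FracConvDiff

end

/-!
Kružkov's doubling of variables. Take the entropy inequality of `u` at `p` with `k = v(q)`, that of
`v` at `q` with `k = u(p)`, and add them. The local terms combine into derivatives of the test
function along the diagonal direction. For the large jumps the Kato type inequality
`sgn(a - b) ((A a' - A b') - (A a - A b)) ≤ |A a' - A b'| - |A a - A b|`, a consequence of the
monotonicity of `A`, lets the jump operator act on `|A(u(p)) - A(v(q))|` with a common jump in `p`
and `q`, and it can then be moved onto the test function. As the truncation radius tends to `0` the
singular parts, which are of the order of the second moment of the small jumps, disappear.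

For a test function `Θ(t) ψ(x) ρ(p - q)` a jump common to `p` and `q` does not change `ρ(p - q)`, so
it only acts on the cutoff `ψ`. Letting `ψ → 1` and then concentrating `ρ` at the origin shows
`0 ≤ ∫ Θ'(t) ‖u(·,t) - v(·,t)‖₁ dt` for all `Θ ≥ 0` supported in `(0, T)`, that is, the continuous
function `t ↦ ‖u(·,t) - v(·,t)‖₁` is nonincreasing.
-/

noncomputable section

namespace FracConvDiff

section LevyMeasure

variable {E : Type*} [NormedAddCommGroup E] [MeasurableSpace E] {ν : Measure E}

/-- Lévy measures on a normed group: they have no atom at the origin and integrate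
`min 1 ‖z‖²`. -/
structure IsLevyMeasure (ν : Measure E) : Prop where
  measure_zero : ν {0} = 0
  integrable_min : Integrable (fun z => min 1 (‖z‖ ^ 2)) ν

/-- The part of a measure carried by the jumps `z` with `r < ‖z‖`. -/
def largeJumps (ν : Measure E) (r : ℝ) : Measure E := ν.restrict {z | r < ‖z‖}

/-- The part of a measure carried by the jumps `z` with `‖z‖ < r`. -/
def smallJumps (ν : Measure E) (r : ℝ) : Measure E := ν.restrict {z | ‖z‖ < r}

instance (r : ℝ) [SFinite ν] : SFinite (largeJumps ν r) := by
  unfold largeJumps; infer_instance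

instance (r : ℝ) [SFinite ν] : SFinite (smallJumps ν r) := by
  unfold smallJumps; infer_instance

lemma isNegInvariant_restrict {G : Type*} [MeasurableSpace G] [InvolutiveNeg G]
    [MeasurableNeg G] {μ : Measure G} [μ.IsNegInvariant] {s : Set G} (hs : -s = s) :
    (μ.restrict s).IsNegInvariant := by
  have h := (Measure.measurePreserving_neg μ).restrict_preimage_emb
    (MeasurableEquiv.neg G).measurableEmbedding s
  rw [Set.neg_preimage, hs] at h
  exact ⟨h.map_eq⟩

lemma IsLevyMeasure.isFiniteMeasure_largeJumps (hν : IsLevyMeasure ν) {r : ℝ} (hr : 0 < r) :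
    IsFiniteMeasure (largeJumps ν r) := by
  refine isFiniteMeasure_restrict.2 (ne_of_lt ?_)
  have hmin : 0 < min 1 (r ^ 2) := by positivity
  refine (measure_mono fun z (hz : r < ‖z‖) => ?_).trans_lt
    (hν.integrable_min.measure_ge_lt_top hmin)
  exact min_le_min le_rfl (pow_le_pow_left₀ hr.le hz.le 2)

variable [BorelSpace E]

instance (r : ℝ) [ν.IsNegInvariant] : (largeJumps ν r).IsNegInvariant :=
  isNegInvariant_restrict (by ext; simp)

lemma measurableSet_norm_lt (r : ℝ) : MeasurableSet {z : E | ‖z‖ < r} :=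
  measurableSet_lt measurable_norm measurable_const

lemma measurableSet_lt_norm (r : ℝ) : MeasurableSet {z : E | r < ‖z‖} :=
  measurableSet_lt measurable_const measurable_norm

namespace IsLevyMeasure

lemma integrable_norm_sq_smallJumps (hν : IsLevyMeasure ν) (r : ℝ) :
    Integrable (fun z => ‖z‖ ^ 2) (smallJumps ν r) := by
  refine ((hν.integrable_min.const_mul (max 1 (r ^ 2))).integrableOn
    (s := {z | ‖z‖ < r})).mono' (by fun_prop) ?_
  refine (ae_restrict_iff' (measurableSet_norm_lt r)).2 (ae_of_all _ fun z (hz : ‖z‖ < r) => ?_)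
  rw [Real.norm_of_nonneg (by positivity)]
  rcases le_total (‖z‖ ^ 2) 1 with h | h
  · rw [min_eq_right h]
    exact le_mul_of_one_le_left (by positivity) (le_max_left _ _)
  · rw [min_eq_left h, mul_one]
    exact (pow_le_pow_left₀ (norm_nonneg _) hz.le 2).trans (le_max_right _ _)

lemma aecover_lt_norm (hν : IsLevyMeasure ν) :
    AECover ν (𝓝[>] 0) fun r : ℝ => {z | r < ‖z‖} where
  ae_eventually_mem := by
    have hne : ∀ᵐ z ∂ν, z ≠ 0 := by simpa [ae_iff] using hν.measure_zero
    filter_upwards [hne] with z hz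
    filter_upwards [Ioo_mem_nhdsGT (norm_pos_iff.2 hz)] with r hr using hr.2
  measurableSet := measurableSet_lt_norm

lemma aecover_lt_norm_smallJumps (hν : IsLevyMeasure ν) (r : ℝ) :
    AECover (smallJumps ν r) (𝓝[>] 0) fun b : ℝ => {z | b < ‖z‖} :=
  hν.aecover_lt_norm.restrict

lemma tendsto_integral_norm_sq_smallJumps (hν : IsLevyMeasure ν) :
    Tendsto (fun r => ∫ z, ‖z‖ ^ 2 ∂(smallJumps ν r)) (𝓝[>] 0) (𝓝 0) := by
  have hint := hν.integrable_norm_sq_smallJumps 1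
  have houter := hν.aecover_lt_norm_smallJumps 1 |>.integral_tendsto_of_countably_generated hint
  have hcompl := houter.const_sub (∫ z, ‖z‖ ^ 2 ∂(smallJumps ν 1))
  rw [sub_self] at hcompl
  have hball (r : ℝ) (hr : r ∈ Ioo (0 : ℝ) 1) : ∫ z, ‖z‖ ^ 2 ∂(smallJumps ν r) ≤
      ∫ z, ‖z‖ ^ 2 ∂(smallJumps ν 1) - ∫ z in {z | r < ‖z‖}, ‖z‖ ^ 2 ∂(smallJumps ν 1) := by
    rw [← setIntegral_compl (measurableSet_lt_norm r) hint, smallJumps, smallJumps,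
      Measure.restrict_restrict (measurableSet_lt_norm r).compl]
    refine setIntegral_mono_set ?_ (ae_of_all _ fun z => by positivity) (ae_of_all _ ?_)
    · exact (hint.mono_measure (Measure.restrict_mono inter_subset_right le_rfl))
    · exact fun z (hz : ‖z‖ < r) => ⟨hz.not_gt, hz.trans hr.2⟩
  refine tendsto_of_tendsto_of_tendsto_of_le_of_le' tendsto_const_nhds hcompl
    (.of_forall fun r => integral_nonneg fun z => by positivity) ?_
  filter_upwards [Ioo_mem_nhdsGT one_pos] using hball

end IsLevyMeasure

end LevyMeasure

section JumpOperators

/-- Half the symmetric second difference of `g` at `p` in the direction `h`. -/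
def secondDiff {S : Type*} [AddGroup S] (g : S → ℝ) (p h : S) : ℝ :=
  (g (p + h) + g (p - h) - 2 * g p) / 2

/-- The nonlocal operator `w ↦ ∫ (w(x + τ z) - w(x)) dm(z)`. The shift `τ` embeds the jumps into
the domain of `w`, so that the same operator acts in some of the variables of `w` only. -/
def jumpOp {E S : Type*} [MeasurableSpace E] [AddGroup S] (m : Measure E) (τ : E → S)
    (w : S → ℝ) (x : S) : ℝ :=
  ∫ z, (w (x + τ z) - w x) ∂m

/-- The symmetrised form of `jumpOp`, which also makes sense for the singular part of a Lévy
measure. -/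
def symmJumpOp {E S : Type*} [MeasurableSpace E] [AddGroup S] (m : Measure E) (τ : E → S)
    (w : S → ℝ) (x : S) : ℝ :=
  ∫ z, secondDiff w x (τ z) ∂m

variable {E S : Type*} [MeasurableSpace E] [AddGroup S] {m : Measure E} {τ : E → S} {w : S → ℝ}
  {x : S} {B : ℝ}

lemma abs_jumpOp_le [IsFiniteMeasure m] (hB : ∀ y, |w y - w x| ≤ B) :
    |jumpOp m τ w x| ≤ B * m.real univ :=
  norm_integral_le_of_norm_le_const (f := fun z => w (x + τ z) - w x)
    (ae_of_all m fun z => hB (x + τ z))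

section Reflection

variable [AddGroup E] [MeasurableNeg E] [m.IsNegInvariant]

lemma jumpOp_neg (hτ : ∀ z, τ (-z) = -τ z) :
    jumpOp m (fun z => -τ z) w x = jumpOp m τ w x := by
  simp only [jumpOp, ← hτ]
  exact integral_neg_eq_self (fun z => w (x + τ z) - w x) m

lemma jumpOp_eq_symmJumpOp (hτ : ∀ z, τ (-z) = -τ z)
    (hw : Integrable (fun z => w (x + τ z) - w x) m) :
    jumpOp m τ w x = symmJumpOp m τ w x := by
  have hw' : Integrable (fun z => w (x + -τ z) - w x) m := by simpa only [hτ] using hw.comp_neg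
  calc jumpOp m τ w x
      = (jumpOp m τ w x + jumpOp m (fun z => -τ z) w x) / 2 := by rw [jumpOp_neg hτ]; ring
    _ = ∫ z, ((w (x + τ z) - w x) + (w (x + -τ z) - w x)) / 2 ∂m := by
        rw [integral_div, integral_add hw hw', jumpOp, jumpOp]
    _ = symmJumpOp m τ w x := by
        simp only [symmJumpOp, secondDiff, sub_eq_add_neg (G := S)]
        congr 1 with z
        ring

end Reflection

variable [MeasurableSpace S] [MeasurableAdd₂ S]

lemma integrable_jump [IsFiniteMeasure m] (hw : Measurable w) (hτ : Measurable τ)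
    (hB : ∀ y, |w y - w x| ≤ B) : Integrable (fun z => w (x + τ z) - w x) m :=
  Integrable.of_bound (by fun_prop : Measurable _).aestronglyMeasurable B
    (ae_of_all _ fun z => hB (x + τ z))

lemma measurable_jumpOp [SFinite m] (hw : Measurable w) (hτ : Measurable τ) :
    Measurable (jumpOp m τ w) := by
  have : Measurable fun p : S × E => w (p.1 + τ p.2) - w p.1 := by fun_prop
  exact this.stronglyMeasurable.integral_prod_right.measurable

variable {μ : Measure S} [SFinite μ] [μ.IsAddRightInvariant] {D Φ : S → ℝ}

lemma integrable_comp_add_prod [IsFiniteMeasure m] (hτ : Measurable τ) (hΦm : Measurable Φ)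
    (hΦ : Integrable Φ μ) : Integrable (fun a : S × E => Φ (a.1 + τ a.2)) (μ.prod m) := by
  have hmeas : Measurable fun a : S × E => Φ (a.1 + τ a.2) := by fun_prop
  rw [integrable_prod_iff' hmeas.aestronglyMeasurable]
  refine ⟨ae_of_all _ fun z => hΦ.comp_add_right (τ z), ?_⟩
  simp only [integral_add_right_eq_self (fun x => ‖Φ x‖)]
  exact integrable_const _

variable [MeasurableNeg S]

lemma measurable_secondDiff (hw : Measurable w) (hτ : Measurable τ) :
    Measurable fun q : S × E => secondDiff w q.1 (τ q.2) := by
  unfold secondDiff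
  fun_prop

lemma measurable_symmJumpOp [SFinite m] (hw : Measurable w) (hτ : Measurable τ) :
    Measurable (symmJumpOp m τ w) :=
  (measurable_secondDiff hw hτ).stronglyMeasurable.integral_prod_right.measurable

lemma integral_jumpOp_mul [IsFiniteMeasure m] (hτ : Measurable τ) (hD : Measurable D)
    (hB : ∀ x, |D x| ≤ B) (hΦm : Measurable Φ) (hΦ : Integrable Φ μ) :
    ∫ x, jumpOp m τ D x * Φ x ∂μ = ∫ x, D x * jumpOp m (fun z => -τ z) Φ x ∂μ := by
  have hΦ₁ : Integrable (fun a : S × E => Φ a.1) (μ.prod m) := hΦ.comp_fst m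
  have hΦ₂ : Integrable (fun a : S × E => Φ (a.1 + -τ a.2)) (μ.prod m) :=
    integrable_comp_add_prod hτ.neg hΦm hΦ
  have hleft : Integrable (fun a : S × E => (D (a.1 + τ a.2) - D a.1) * Φ a.1) (μ.prod m) :=
    hΦ₁.bdd_mul (c := B + B) (by fun_prop : Measurable _).aestronglyMeasurable
      (ae_of_all _ fun a => (norm_sub_le _ _).trans (add_le_add (hB _) (hB _)))
  have hright : Integrable (fun a : S × E => D a.1 * (Φ (a.1 + -τ a.2) - Φ a.1)) (μ.prod m) :=
    (hΦ₂.sub hΦ₁).bdd_mul (c := B) (by fun_prop : Measurable _).aestronglyMeasurable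
      (ae_of_all _ fun a => hB _)
  have htranslate (z : E) : ∫ x, (D (x + τ z) - D x) * Φ x ∂μ =
      ∫ x, D x * (Φ (x + -τ z) - Φ x) ∂μ := by
    have hmul {Ψ : S → ℝ} (hΨ : Integrable Ψ μ) (y : S) :
        Integrable (fun x => D (x + y) * Ψ x) μ :=
      hΨ.bdd_mul (c := B) (by fun_prop : Measurable _).aestronglyMeasurable
        (ae_of_all _ fun x => hB _)
    have hDΦ : Integrable (fun x => D x * Φ x) μ := by simpa only [add_zero] using hmul hΦ 0
    have hshift := integral_add_right_eq_self (μ := μ) (fun x => D x * Φ (x + -τ z)) (τ z)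
    simp only [add_neg_cancel_right] at hshift
    simp only [sub_mul, mul_sub]
    rw [integral_sub (hmul hΦ _) hDΦ, integral_sub _ hDΦ, hshift]
    simpa only [add_zero] using hmul (hΦ.comp_add_right (-τ z)) 0
  calc ∫ x, jumpOp m τ D x * Φ x ∂μ
      = ∫ z, ∫ x, (D (x + τ z) - D x) * Φ x ∂μ ∂m := by
        simp only [jumpOp, ← integral_mul_const]
        exact integral_integral_swap hleft
    _ = ∫ z, ∫ x, D x * (Φ (x + -τ z) - Φ x) ∂μ ∂m := by simp only [htranslate]
    _ = ∫ x, D x * jumpOp m (fun z => -τ z) Φ x ∂μ := by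
        simp only [jumpOp, ← integral_const_mul]
        exact (integral_integral_swap hright).symm

end JumpOperators

section PrincipalValue

variable {E : Type*} [NormedAddCommGroup E] [MeasurableSpace E] [BorelSpace E]
  [SecondCountableTopology E] {ν : Measure E}

lemma tendsto_jumpOp_annulus [ν.IsNegInvariant] (hν : IsLevyMeasure ν) {w : E → ℝ}
    (hw : Measurable w) {x : E} {B C : ℝ} (hB : ∀ y, |w y - w x| ≤ B)
    (hC : ∀ z, |secondDiff w x z| ≤ C * ‖z‖ ^ 2) (r : ℝ) :
    Tendsto (fun b => jumpOp (ν.restrict {z | b < ‖z‖ ∧ ‖z‖ < r}) id w x) (𝓝[>] 0)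
      (𝓝 (symmJumpOp (smallJumps ν r) id w x)) := by
  have hmeas : Measurable (secondDiff w x) := by unfold secondDiff; fun_prop
  have hint : Integrable (secondDiff w x) (smallJumps ν r) :=
    ((hν.integrable_norm_sq_smallJumps r).const_mul C).mono' hmeas.aestronglyMeasurable
      (ae_of_all _ hC)
  refine ((hν.aecover_lt_norm_smallJumps r).integral_tendsto_of_countably_generated hint).congr' ?_
  filter_upwards [self_mem_nhdsWithin] with b hb
  have hrestrict : (smallJumps ν r).restrict {z | b < ‖z‖} =
      ν.restrict {z | b < ‖z‖ ∧ ‖z‖ < r} := by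
    rw [smallJumps, Measure.restrict_restrict (measurableSet_lt_norm b)]
    rfl
  have hfin : IsFiniteMeasure (ν.restrict {z | b < ‖z‖ ∧ ‖z‖ < r}) := by
    have := hν.isFiniteMeasure_largeJumps hb
    exact isFiniteMeasure_of_le (largeJumps ν b) (Measure.restrict_mono (fun z hz => hz.1) le_rfl)
  have : (ν.restrict {z | b < ‖z‖ ∧ ‖z‖ < r}).IsNegInvariant :=
    isNegInvariant_restrict (by ext; simp)
  rw [hrestrict]
  exact (jumpOp_eq_symmJumpOp (τ := id) (fun _ => rfl)
    (integrable_jump hw measurable_id hB)).symm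

end PrincipalValue

section SecondDifference

variable {E : Type*} [NormedAddCommGroup E]

lemma abs_secondDiff_le_of_bounded {g : E → ℝ} {M : ℝ} (hM : ∀ x, |g x| ≤ M) (p h : E) :
    |secondDiff g p h| ≤ 2 * M := by
  have h₁ := abs_le.1 (hM (p + h))
  have h₂ := abs_le.1 (hM (p - h))
  have h₃ := abs_le.1 (hM p)
  rw [secondDiff, abs_le]
  constructor <;> linarith

lemma secondDiff_eq_zero_of_notMem_cthickening {g : E → ℝ} {p h : E} {δ : ℝ} (hh : ‖h‖ ≤ δ)
    (hp : p ∉ Metric.cthickening δ (tsupport g)) : secondDiff g p h = 0 := by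
  have hδ : 0 ≤ δ := (norm_nonneg h).trans hh
  have hzero (y : E) (hy : dist p y ≤ δ) : g y = 0 := by
    refine image_eq_zero_of_notMem_tsupport fun hmem => hp ?_
    exact Metric.mem_cthickening_of_dist_le p y δ _ hmem hy
  rw [secondDiff, hzero (p + h) (by simpa), hzero (p - h) (by simpa [dist_eq_norm]),
    hzero p (by simpa)]
  norm_num

variable [NormedSpace ℝ E]

lemma abs_secondDiff_le_of_lipschitzWith_fderiv {g : E → ℝ} {K : ℝ≥0} (hg : Differentiable ℝ g)
    (hK : LipschitzWith K (fderiv ℝ g)) (p h : E) : |secondDiff g p h| ≤ K * ‖h‖ ^ 2 := by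
  have hder : ∀ y ∈ Metric.closedBall (0 : E) ‖h‖,
      HasFDerivWithinAt (fun y => g (p + y) + g (p - y))
        (fderiv ℝ g (p + y) - fderiv ℝ g (p - y)) (Metric.closedBall 0 ‖h‖) y := by
    intro y _
    have hadd : HasFDerivAt (fun y => g (p + y)) (fderiv ℝ g (p + y)) y :=
      (hg (p + y)).hasFDerivAt.comp y ((hasFDerivAt_id y).const_add p)
    have hsub : HasFDerivAt (fun y => g (p - y)) (-fderiv ℝ g (p - y)) y := by
      simpa [Function.comp_def] using
        (hg (p - y)).hasFDerivAt.comp y ((hasFDerivAt_id y).const_sub p)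
    rw [sub_eq_add_neg]
    exact (hadd.add hsub).hasFDerivWithinAt
  have hbound : ∀ y ∈ Metric.closedBall (0 : E) ‖h‖,
      ‖fderiv ℝ g (p + y) - fderiv ℝ g (p - y)‖ ≤ K * (2 * ‖h‖) := by
    intro y hy
    have hdist : ‖p + y - (p - y)‖ ≤ 2 * ‖h‖ := by
      rw [add_sub_sub_cancel, two_mul]
      exact norm_add_le_of_le (mem_closedBall_zero_iff.1 hy) (mem_closedBall_zero_iff.1 hy)
    exact (hK.norm_sub_le _ _).trans (mul_le_mul_of_nonneg_left hdist K.2)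
  have hmvt := (convex_closedBall (0 : E) ‖h‖).norm_image_sub_le_of_norm_hasFDerivWithin_le
    hder hbound (x := 0) (y := h) (by simp) (by simp)
  simp only [add_zero, sub_zero, Real.norm_eq_abs] at hmvt
  rw [secondDiff, abs_div, abs_two, div_le_iff₀ two_pos, two_mul (g p)]
  exact hmvt.trans_eq (by ring)

section Smooth

variable {g : E → ℝ} (hg : ContDiff ℝ ∞ g) (hgc : HasCompactSupport g)
include hg hgc

lemma exists_abs_secondDiff_le_norm_sq :
    ∃ C : ℝ, ∀ p h, |secondDiff g p h| ≤ C * ‖h‖ ^ 2 := by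
  have hD : ContDiff ℝ 1 (fderiv ℝ g) := (contDiff_infty.1 hg 2).fderiv_right (by norm_num)
  obtain ⟨K, hK⟩ := ContDiff.lipschitzWith_of_hasCompactSupport (hgc.fderiv ℝ) hD one_ne_zero
  exact ⟨K, abs_secondDiff_le_of_lipschitzWith_fderiv (hg.differentiable (by simp)) hK⟩

lemma exists_abs_secondDiff_le_min :
    ∃ C : ℝ, ∀ p h, |secondDiff g p h| ≤ C * min 1 (‖h‖ ^ 2) := by
  obtain ⟨C, hC⟩ := exists_abs_secondDiff_le_norm_sq hg hgc
  obtain ⟨M, hM⟩ := hg.continuous.bounded_above_of_compact_support hgc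
  refine ⟨max C (2 * M), fun p h => ?_⟩
  rcases le_total 1 (‖h‖ ^ 2) with hle | hle
  · rw [min_eq_left hle, mul_one]
    exact (abs_secondDiff_le_of_bounded hM p h).trans (le_max_right _ _)
  · rw [min_eq_right hle]
    exact (hC p h).trans (mul_le_mul_of_nonneg_right (le_max_left _ _) (by positivity))

lemma exists_abs_secondDiff_le_indicator [ProperSpace E] :
    ∃ (C : ℝ) (K : Set E), IsCompact K ∧
      ∀ p h, ‖h‖ ≤ 1 → |secondDiff g p h| ≤ K.indicator (fun _ => C * ‖h‖ ^ 2) p := by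
  obtain ⟨C, hC⟩ := exists_abs_secondDiff_le_norm_sq hg hgc
  refine ⟨C, Metric.cthickening 1 (tsupport g), hgc.isCompact.cthickening, fun p h hh => ?_⟩
  by_cases hp : p ∈ Metric.cthickening 1 (tsupport g)
  · rw [indicator_of_mem hp]
    exact hC p h
  · rw [indicator_of_notMem hp, secondDiff_eq_zero_of_notMem_cthickening hh hp, abs_zero]

end Smooth

end SecondDifference

section FractionalLaplacian

variable {d : ℕ} {c lam : ℝ}

/-- The density `c |z|^(-d-λ)` of the Lévy measure of the fractional Laplacian. -/
def fracLevyDensity (d : ℕ) (c lam : ℝ) (z : Space d) : ℝ := c / ‖z‖ ^ ((d : ℝ) + lam)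

/-- The Lévy measure `c |z|^(-d-λ) dz` of the fractional Laplacian. -/
def fracLevyMeasure (d : ℕ) (c lam : ℝ) : Measure (Space d) :=
  volume.withDensity fun z => ENNReal.ofReal (fracLevyDensity d c lam z)

instance : SFinite (fracLevyMeasure d c lam) := by unfold fracLevyMeasure; infer_instance

lemma measurable_fracLevyDensity : Measurable (fracLevyDensity d c lam) := by
  unfold fracLevyDensity; fun_prop

lemma fracLevyDensity_nonneg (hc : 0 < c) (z : Space d) : 0 ≤ fracLevyDensity d c lam z := by
  unfold fracLevyDensity; positivity

instance : (fracLevyMeasure d c lam).IsNegInvariant := by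
  refine ⟨?_⟩
  ext s hs
  rw [Measure.neg, Measure.map_apply measurable_neg hs, fracLevyMeasure, withDensity_apply _ hs,
    withDensity_apply _ (measurable_neg hs), ← lintegral_indicator hs,
    ← lintegral_indicator (measurable_neg hs), ← lintegral_neg_eq_self]
  congr 1 with z
  by_cases h : z ∈ s <;> simp [indicator, h, fracLevyDensity]

lemma setIntegral_fracLevyMeasure (hc : 0 < c) {s : Set (Space d)} (hs : MeasurableSet s)
    (g : Space d → ℝ) :
    ∫ z in s, g z ∂(fracLevyMeasure d c lam) = c * ∫ z in s, g z / ‖z‖ ^ ((d : ℝ) + lam) := by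
  rw [fracLevyMeasure, setIntegral_withDensity_eq_setIntegral_toReal_smul
    measurable_fracLevyDensity.ennreal_ofReal (by simp) _ hs, ← integral_const_mul]
  congr 1 with z
  rw [ENNReal.toReal_ofReal (fracLevyDensity_nonneg hc z), fracLevyDensity, smul_eq_mul]
  ring

lemma integrableOn_Ioi_rpow_mul_min_sq (hlam : lam ∈ Ioo (0 : ℝ) 2) :
    IntegrableOn (fun y : ℝ => y ^ (-1 - lam) * min 1 (y ^ 2)) (Ioi 0) := by
  rw [← Ioc_union_Ioi_eq_Ioi zero_le_one]
  refine IntegrableOn.union ?_ ?_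
  · have hnear : IntegrableOn (fun y : ℝ => y ^ (1 - lam)) (Ioc 0 1) := by
      rw [← intervalIntegrable_iff_integrableOn_Ioc_of_le zero_le_one]
      exact intervalIntegral.intervalIntegrable_rpow' (by linarith [hlam.2])
    refine hnear.congr_fun (fun y hy => ?_) measurableSet_Ioc
    dsimp only
    rw [min_eq_right (pow_le_one₀ hy.1.le hy.2), ← Real.rpow_natCast, ← Real.rpow_add hy.1]
    congr 1
    push_cast
    ring
  · have hfar : IntegrableOn (fun y : ℝ => y ^ (-1 - lam)) (Ioi 1) :=
      integrableOn_Ioi_rpow_of_lt (by linarith [hlam.1]) one_pos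
    refine hfar.congr_fun (fun y (hy : 1 < y) => ?_) measurableSet_Ioi
    dsimp only
    rw [min_eq_left (one_le_pow₀ hy.le), mul_one]

lemma integrable_min_fracLevyMeasure (hd : 0 < d) (hlam : lam ∈ Ioo (0 : ℝ) 2) (hc : 0 < c) :
    Integrable (fun z => min 1 (‖z‖ ^ 2)) (fracLevyMeasure d c lam) := by
  have : Nonempty (Fin d) := ⟨⟨0, hd⟩⟩
  rw [fracLevyMeasure, integrable_withDensity_iff_integrable_smul'
    measurable_fracLevyDensity.ennreal_ofReal (by simp)]
  simp only [ENNReal.toReal_ofReal (fracLevyDensity_nonneg hc _)]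
  simp only [fracLevyDensity]
  rw [integrable_fun_norm_addHaar (μ := (volume : Measure (Space d)))
    (f := fun y => (c / y ^ ((d : ℝ) + lam)) • min 1 (y ^ 2)), finrank_euclideanSpace_fin]
  refine IntegrableOn.congr_fun ((integrableOn_Ioi_rpow_mul_min_sq hlam).const_mul c)
    (fun y (hy : 0 < y) => ?_) measurableSet_Ioi
  have hpow : (y ^ (d - 1) : ℝ) = y ^ ((d : ℝ) - 1) := by
    rw [← Real.rpow_natCast, Nat.cast_sub hd, Nat.cast_one]
  have hexp : -1 - lam = (d : ℝ) - 1 + -((d : ℝ) + lam) := by ring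
  simp only [smul_eq_mul]
  rw [hpow, hexp, Real.rpow_add hy, Real.rpow_neg hy.le]
  ring

lemma isLevyMeasure_fracLevyMeasure (hd : 0 < d) (hlam : lam ∈ Ioo (0 : ℝ) 2) (hc : 0 < c) :
    IsLevyMeasure (fracLevyMeasure d c lam) where
  measure_zero := by
    have : Nonempty (Fin d) := ⟨⟨0, hd⟩⟩
    exact withDensity_absolutelyContinuous _ _ (measure_singleton 0)
  integrable_min := integrable_min_fracLevyMeasure hd hlam hc

lemma gOuter_eq_jumpOp (hc : 0 < c) (r : ℝ) (w : Space d → ℝ) (x : Space d) :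
    gOuter c lam r w x = jumpOp (largeJumps (fracLevyMeasure d c lam) r) id w x :=
  (setIntegral_fracLevyMeasure hc (measurableSet_lt_norm r) _).symm

lemma gInner_eq_symmJumpOp (hd : 0 < d) (hlam : lam ∈ Ioo (0 : ℝ) 2) (hc : 0 < c) (r : ℝ)
    {w : Space d → ℝ} (hw : Measurable w) {x : Space d} {B C : ℝ} (hB : ∀ y, |w y - w x| ≤ B)
    (hC : ∀ z, |secondDiff w x z| ≤ C * ‖z‖ ^ 2) :
    gInner c lam r w x = symmJumpOp (smallJumps (fracLevyMeasure d c lam) r) id w x := by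
  have hlim := tendsto_jumpOp_annulus (isLevyMeasure_fracLevyMeasure hd hlam hc) hw hB hC r
  have hannulus (b : ℝ) : MeasurableSet {z : Space d | b < ‖z‖ ∧ ‖z‖ < r} :=
    (measurableSet_lt_norm b).inter (measurableSet_norm_lt r)
  simp only [jumpOp, setIntegral_fracLevyMeasure hc (hannulus _), id_eq] at hlim
  have hlim' := hlim.const_mul c⁻¹
  simp only [inv_mul_cancel_left₀ hc.ne'] at hlim'
  rw [gInner, hlim'.limUnder_eq, mul_inv_cancel_left₀ hc.ne']

end FractionalLaplacian

section EntropySolution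

variable {d : ℕ}

/-- Space-time `ℝ^d × ℝ`. -/
abbrev SpaceTime (d : ℕ) : Type := Space d × ℝ

/-- The shift of space-time by a jump in the space variable. -/
def spaceShift (z : Space d) : SpaceTime d := (z, 0)

lemma measurable_spaceShift : Measurable (spaceShift (d := d)) :=
  measurable_id.prodMk measurable_const

@[simp]
lemma spaceShift_neg (z : Space d) : spaceShift (-z) = -spaceShift z := by simp [spaceShift]

@[simp]
lemma norm_spaceShift (z : Space d) : ‖spaceShift z‖ = ‖z‖ := by simp [spaceShift]

/-- The space-time entropy flux `(q_k(u), η_k(u))`. -/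
def fluxVec (f : ℝ → Space d) (k u : ℝ) : SpaceTime d := (flux f k u, eta k u)

/-- The integrand of the entropy inequality for the symmetric Lévy operator with Lévy measure
`ν`. -/
def kruzkovIntegrand (ν : Measure (Space d)) (f : ℝ → Space d) (A : ℝ → ℝ)
    (U : SpaceTime d → ℝ) (k r : ℝ) (φ : SpaceTime d → ℝ) (p : SpaceTime d) : ℝ :=
  fderiv ℝ φ p (fluxVec f k (U p)) +
    |A (U p) - A k| * symmJumpOp (smallJumps ν r) spaceShift φ p +
    Real.sign (U p - k) * jumpOp (largeJumps ν r) spaceShift (A ∘ U) p * φ p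

/-- Bounded, integrable, everywhere measurable functions on the whole space-time which satisfy the
entropy inequalities of `∂ₜu + ∇·f(u) = L A(u)`, where `L` is the symmetric Lévy operator with
Lévy measure `ν`, for the test functions supported in `ℝ^d × (0,T)`. -/
structure IsLevyEntropySolution (ν : Measure (Space d)) (T : ℝ) (f : ℝ → Space d) (A : ℝ → ℝ)
    (U : SpaceTime d → ℝ) : Prop where
  measurable : Measurable U
  integrable : Integrable U
  bounded : ∃ M, ∀ p, |U p| ≤ M
  ineq : ∀ k r : ℝ, 0 < r → ∀ φ : SpaceTime d → ℝ, IsNonnegTest T φ →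
    0 ≤ ∫ p, kruzkovIntegrand ν f A U k r φ p

lemma measurableSet_cylinder (T : ℝ) : MeasurableSet (cylinder d T) :=
  MeasurableSet.univ.prod measurableSet_Ioo

lemma restrict_cylinder (T : ℝ) : (volume : Measure (SpaceTime d)).restrict (cylinder d T) =
    (volume : Measure (Space d)).prod (volume.restrict (Ioo 0 T)) := by
  rw [cylinder, Measure.volume_eq_prod, ← Measure.prod_restrict, Measure.restrict_univ]

lemma ae_ae_of_ae_cylinder {T : ℝ} {P : SpaceTime d → Prop}
    (h : ∀ᵐ p ∂(volume.restrict (cylinder d T)), P p) :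
    ∀ᵐ t ∂(volume.restrict (Ioo 0 T)), ∀ᵐ x, P (x, t) := by
  rw [restrict_cylinder] at h
  exact Measure.ae_ae_of_ae_prod ((Measure.measurePreserving_swap
    (μ := volume.restrict (Ioo 0 T))).quasiMeasurePreserving.ae h)

lemma ae_cylinder_of_ae {T : ℝ} {P : ℝ → Prop} (h : ∀ᵐ t ∂(volume.restrict (Ioo 0 T)), P t) :
    ∀ᵐ p ∂(volume.restrict (cylinder d T)), P p.2 := by
  rw [restrict_cylinder]
  exact Measure.quasiMeasurePreserving_snd.ae h

namespace MemCL1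

variable {T : ℝ} {u v : Space d → ℝ → ℝ}

/-- The curve `t ↦ u(·,t)` in `L¹`. -/
def curve (hu : MemCL1 T u) (t : Icc 0 T) : Lp ℝ 1 (volume : Measure (Space d)) :=
  (hu.1 t t.2).toLp _

lemma continuous_curve (hu : MemCL1 T u) : Continuous hu.curve := by
  rw [continuous_iff_continuousAt]
  intro t
  rw [ContinuousAt, tendsto_iff_edist_tendsto_0]
  have hlim := (hu.2 t t.2).comp (tendsto_nhdsWithin_iff.2
    ⟨continuous_subtype_val.continuousAt.tendsto, .of_forall fun s : Icc 0 T => s.2⟩)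
  refine hlim.congr fun s => ?_
  rw [curve, curve, Lp.edist_toLp_toLp]
  rfl

lemma norm_curve (hu : MemCL1 T u) (t : Icc 0 T) : ‖hu.curve t‖ = ∫ x, ‖u x t‖ := by
  rw [curve, Lp.norm_toLp, eLpNorm_one_eq_lintegral_enorm,
    integral_norm_eq_lintegral_enorm (hu.1 t t.2).1]

lemma norm_curve_sub (hu : MemCL1 T u) (hv : MemCL1 T v) (t : Icc 0 T) :
    ‖hu.curve t - hv.curve t‖ = (eLpNorm (fun x => u x t - v x t) 1 volume).toReal := by
  rw [curve, curve, ← MemLp.toLp_sub, Lp.norm_toLp]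
  rfl

lemma exists_integral_norm_le (hu : MemCL1 T u) : ∃ B, ∀ t ∈ Icc 0 T, ∫ x, ‖u x t‖ ≤ B := by
  obtain ⟨B, hB⟩ := (isCompact_range hu.continuous_curve.norm).bddAbove
  refine ⟨B, fun t ht => ?_⟩
  rw [← hu.norm_curve ⟨t, ht⟩]
  exact hB ⟨_, rfl⟩

lemma integrable_of_ae_eq (hu : MemCL1 T u) {U : SpaceTime d → ℝ} (hUm : Measurable U)
    (huU : ∀ᵐ p ∂(volume.restrict (cylinder d T)), u p.1 p.2 = U p)
    (hU0 : ∀ p ∉ cylinder d T, U p = 0) : Integrable U := by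
  obtain ⟨B, hB⟩ := hu.exists_integral_norm_le
  have hslice := ae_ae_of_ae_cylinder huU
  refine (integrableOn_iff_integrable_of_support_subset (s := cylinder d T)
    fun p hp => by_contra fun h => hp (hU0 p h)).1 ?_
  rw [IntegrableOn, restrict_cylinder, integrable_prod_iff' hUm.aestronglyMeasurable]
  constructor
  · filter_upwards [hslice, ae_restrict_mem measurableSet_Ioo] with t ht htT
    exact (memLp_one_iff_integrable.1 (hu.1 t (Ioo_subset_Icc_self htT))).congr ht
  · refine Integrable.of_bound
      hUm.norm.stronglyMeasurable.integral_prod_left'.aestronglyMeasurable B ?_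
    filter_upwards [hslice, ae_restrict_mem measurableSet_Ioo] with t ht htT
    rw [Real.norm_of_nonneg (integral_nonneg fun _ => norm_nonneg _)]
    refine (integral_congr_ae ?_).trans_le (hB t (Ioo_subset_Icc_self htT))
    filter_upwards [ht] with x hx
    rw [hx]

end MemCL1

lemma exists_bounded_representative {X : Type*} [MeasurableSpace X] {μ : Measure X} {Q : Set X}
    (hQ : MeasurableSet Q) {u : X → ℝ} (hu : MemLp u ∞ (μ.restrict Q)) :
    ∃ U : X → ℝ, Measurable U ∧ (∃ M, ∀ p, |U p| ≤ M) ∧ (∀ p ∉ Q, U p = 0) ∧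
      u =ᵐ[μ.restrict Q] U := by
  obtain ⟨w, hw, huw⟩ := hu.1
  set M : ℝ := (eLpNorm u ∞ (μ.restrict Q)).toReal
  have hM : ∀ᵐ p ∂(μ.restrict Q), |u p| ≤ M := by
    filter_upwards [ae_le_eLpNormEssSup (f := u) (μ := μ.restrict Q)] with p hp
    rw [← Real.norm_eq_abs, ← toReal_enorm]
    exact ENNReal.toReal_mono hu.2.ne (hp.trans_eq eLpNorm_exponent_top.symm)
  refine ⟨(Q ∩ {p | |w p| ≤ M}).indicator w, ?_, ⟨M, fun p => ?_⟩, fun p hp => ?_, ?_⟩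
  · exact hw.measurable.indicator
      (hQ.inter (measurableSet_le hw.measurable.abs measurable_const))
  · by_cases hp : p ∈ Q ∩ {p | |w p| ≤ M}
    · rw [indicator_of_mem hp]
      exact hp.2
    · rw [indicator_of_notMem hp, abs_zero]
      exact ENNReal.toReal_nonneg
  · exact indicator_of_notMem (fun h => hp h.1) _
  · filter_upwards [huw, hM, ae_restrict_mem hQ] with p huw hM hp
    have hmem : p ∈ Q ∩ {p | |w p| ≤ M} := ⟨hp, show |w p| ≤ M from huw ▸ hM⟩
    rw [indicator_of_mem hmem, huw]

lemma fderiv_prodMk_apply {φ : SpaceTime d → ℝ} (hφ : Differentiable ℝ φ) (x : Space d) (t : ℝ)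
    (w : Space d) (a : ℝ) :
    fderiv ℝ φ (x, t) (w, a) =
      a * deriv (fun s => φ (x, s)) t + inner ℝ w (gradient (fun y => φ (y, t)) x) := by
  have hD := (hφ (x, t)).hasFDerivAt
  have htime : HasFDerivAt (fun s : ℝ => φ (x, s))
      ((fderiv ℝ φ (x, t)).comp (ContinuousLinearMap.inr ℝ (Space d) ℝ)) t :=
    hD.comp t (hasFDerivAt_prodMk_right x t)
  have hspace : HasFDerivAt (fun y : Space d => φ (y, t))
      ((fderiv ℝ φ (x, t)).comp (ContinuousLinearMap.inl ℝ (Space d) ℝ)) x :=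
    hD.comp x (hasFDerivAt_prodMk_left x t)
  have hsplit : ((w, a) : SpaceTime d) = a • (0, 1) + (w, 0) := by simp
  rw [gradient, real_inner_comm, InnerProductSpace.toDual_symm_apply, hspace.fderiv,
    htime.hasDerivAt.deriv, hsplit, map_add, map_smul]
  simp

lemma IsNonnegTest.eq_zero_of_notMem {T : ℝ} {φ : SpaceTime d → ℝ} (hφ : IsNonnegTest T φ)
    {x : Space d} {t : ℝ} (ht : t ∉ Ioo 0 T) : φ (x, t) = 0 :=
  image_eq_zero_of_notMem_tsupport fun h => ht (hφ.support_subset h).2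

lemma kruzkovIntegrand_eq_zero {T : ℝ} {φ : SpaceTime d → ℝ} (hφ : IsNonnegTest T φ)
    (ν : Measure (Space d)) (f : ℝ → Space d) (A : ℝ → ℝ) (U : SpaceTime d → ℝ) (k r : ℝ)
    {p : SpaceTime d} (hp : p ∉ cylinder d T) : kruzkovIntegrand ν f A U k r φ p = 0 := by
  obtain ⟨x, t⟩ := p
  have ht : t ∉ Ioo 0 T := fun h => hp ⟨mem_univ _, h⟩
  have hfderiv : fderiv ℝ φ (x, t) = 0 :=
    by_contra fun h => hp (hφ.support_subset (support_fderiv_subset ℝ h))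
  simp [kruzkovIntegrand, hfderiv, symmJumpOp, secondDiff, spaceShift, hφ.eq_zero_of_notMem ht]

lemma symmJumpOp_id_slice (m : Measure (Space d)) (φ : SpaceTime d → ℝ) (x : Space d) (t : ℝ) :
    symmJumpOp m id (fun y => φ (y, t)) x = symmJumpOp m spaceShift φ (x, t) := by
  simp [symmJumpOp, secondDiff, spaceShift]

section Fractional

variable {c lam : ℝ} (hd : 0 < d) (hlam : lam ∈ Ioo (0 : ℝ) 2) (hc : 0 < c)

include hc in
lemma gOuter_eq_jumpOp_spaceShift {w : Space d → ℝ} {W : SpaceTime d → ℝ} {x : Space d} {t : ℝ}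
    (hx : w x = W (x, t)) (hslice : ∀ᵐ y, w y = W (y, t)) (r : ℝ) :
    gOuter c lam r w x = jumpOp (largeJumps (fracLevyMeasure d c lam) r) spaceShift W (x, t) := by
  rw [gOuter_eq_jumpOp hc]
  refine integral_congr_ae (ae_restrict_of_ae
    ((withDensity_absolutelyContinuous _ _).ae_le ?_))
  filter_upwards [(quasiMeasurePreserving_add_left volume x).ae hslice] with z hz
  simp only [id_eq, hz, hx, spaceShift, Prod.mk_add_mk, add_zero]

include hd hlam hc

lemma gInner_eq_symmJumpOp_spaceShift {φ : SpaceTime d → ℝ} (hφ : ContDiff ℝ ∞ φ)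
    (hφc : HasCompactSupport φ) (r : ℝ) (x : Space d) (t : ℝ) :
    gInner c lam r (fun y => φ (y, t)) x =
      symmJumpOp (smallJumps (fracLevyMeasure d c lam) r) spaceShift φ (x, t) := by
  obtain ⟨C, hC⟩ := exists_abs_secondDiff_le_norm_sq hφ hφc
  obtain ⟨N, hN⟩ := hφc.exists_bound_of_continuous hφ.continuous
  rw [← symmJumpOp_id_slice]
  refine gInner_eq_symmJumpOp hd hlam hc r (B := N + N) (C := C)
    (hφ.continuous.comp (by fun_prop : Continuous fun y : Space d => (y, t))).measurable
    (fun y => (norm_sub_le _ _).trans (add_le_add (hN _) (hN _))) fun z => ?_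
  simpa [secondDiff] using hC (x, t) (z, 0)

lemma entropyIntegrand_eq_kruzkovIntegrand {f : ℝ → Space d} {A : ℝ → ℝ} {u : Space d → ℝ → ℝ}
    {U : SpaceTime d → ℝ} {φ : SpaceTime d → ℝ} (hφ : ContDiff ℝ ∞ φ) (hφc : HasCompactSupport φ)
    {x : Space d} {t : ℝ} (hx : u x t = U (x, t)) (hslice : ∀ᵐ y, u y t = U (y, t)) (k r : ℝ) :
    entropyIntegrand c lam f A u k r φ x t =
      kruzkovIntegrand (fracLevyMeasure d c lam) f A U k r φ (x, t) := by
  have houter := gOuter_eq_jumpOp_spaceShift (lam := lam) hc (w := fun y => A (u y t))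
    (W := A ∘ U) (congrArg A hx) (hslice.mono fun y hy => congrArg A hy) r
  rw [entropyIntegrand, kruzkovIntegrand, fluxVec,
    fderiv_prodMk_apply (hφ.differentiable (by simp)),
    gInner_eq_symmJumpOp_spaceShift hd hlam hc hφ hφc, houter, hx]
  simp only [eta, eta']

theorem IsEntropySolution.exists_isLevyEntropySolution {T : ℝ} {f : ℝ → Space d} {A : ℝ → ℝ}
    {u₀ : Space d → ℝ} {u : Space d → ℝ → ℝ} (hu : IsEntropySolution c lam T f A u₀ u) :
    ∃ U : SpaceTime d → ℝ, IsLevyEntropySolution (fracLevyMeasure d c lam) T f A U ∧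
      ∀ᵐ p ∂(volume.restrict (cylinder d T)), u p.1 p.2 = U p := by
  obtain ⟨U, hUm, hUb, hU0, huU⟩ :=
    exists_bounded_representative (measurableSet_cylinder T) hu.memLinfty
  refine ⟨U, ⟨hUm, hu.memCL1.integrable_of_ae_eq hUm huU hU0, hUb, fun k r hr φ hφ => ?_⟩, huU⟩
  refine (hu.entropy_ineq k r hr φ hφ).trans_eq ?_
  rw [← setIntegral_eq_integral_of_forall_compl_eq_zero
    fun p hp => kruzkovIntegrand_eq_zero hφ _ f A U k r hp]
  refine integral_congr_ae ?_
  filter_upwards [huU, ae_cylinder_of_ae (ae_ae_of_ae_cylinder huU)] with p hp hslice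
  exact entropyIntegrand_eq_kruzkovIntegrand hd hlam hc hφ.smooth hφ.compact hp hslice k r

end Fractional

end EntropySolution

section Bounds

lemma integrable_bounded_mul {E : Type*} [TopologicalSpace E] [MeasurableSpace E]
    [OpensMeasurableSpace E] {μ : Measure E} [IsFiniteMeasureOnCompacts μ] {Φ : E → ℝ}
    (hΦ : Continuous Φ) (hΦc : HasCompactSupport Φ) {s : E → ℝ} (hs : Measurable s) {B : ℝ}
    (hB : ∀ p, |s p| ≤ B) : Integrable (fun p => s p * Φ p) μ :=
  (hΦ.integrable_of_hasCompactSupport hΦc).bdd_mul hs.aestronglyMeasurable (ae_of_all _ hB)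

lemma integrable_fderiv_apply {E : Type*} [NormedAddCommGroup E] [NormedSpace ℝ E]
    [FiniteDimensional ℝ E] [MeasurableSpace E] [BorelSpace E] {μ : Measure E}
    [IsFiniteMeasureOnCompacts μ] {Φ : E → ℝ} (hΦ : ContDiff ℝ ∞ Φ) (hΦc : HasCompactSupport Φ)
    {w : E → E} (hw : Measurable w) {B : ℝ} (hB : ∀ p, ‖w p‖ ≤ B) :
    Integrable (fun p => fderiv ℝ Φ p (w p)) μ := by
  have hcont : Continuous (fderiv ℝ Φ) := hΦ.continuous_fderiv (by simp)
  have hdom : Integrable (fun p => ‖fderiv ℝ Φ p‖ * B) μ :=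
    ((hcont.integrable_of_hasCompactSupport (hΦc.fderiv ℝ)).norm).mul_const B
  refine hdom.mono' ?_ (ae_of_all _ fun p => ?_)
  · have hpair : StronglyMeasurable fun p => (fderiv ℝ Φ p, w p) :=
      hcont.stronglyMeasurable.prodMk hw.stronglyMeasurable
    exact (isBoundedBilinearMap_apply.continuous.comp_stronglyMeasurable
      hpair).aestronglyMeasurable
  · exact ((fderiv ℝ Φ p).le_opNorm _).trans (by gcongr; exact hB p)

lemma fderiv_slice_fst {E F : Type*} [NormedAddCommGroup E] [NormedSpace ℝ E]
    [NormedAddCommGroup F] [NormedSpace ℝ F] {Φ : E × F → ℝ} (hΦ : Differentiable ℝ Φ)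
    (p : E) (q : F) (w : E) :
    fderiv ℝ (fun p => Φ (p, q)) p w = fderiv ℝ Φ (p, q) (w, 0) := by
  have h : HasFDerivAt (fun p => Φ (p, q))
      ((fderiv ℝ Φ (p, q)).comp (ContinuousLinearMap.inl ℝ E F)) p :=
    (hΦ (p, q)).hasFDerivAt.comp p (hasFDerivAt_prodMk_left p q)
  rw [h.fderiv]
  simp

lemma hasCompactSupport_slice_fst {X Y : Type*} [TopologicalSpace X] [TopologicalSpace Y]
    [T2Space X] {Φ : X × Y → ℝ} (hΦ : HasCompactSupport Φ) (q : Y) :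
    HasCompactSupport fun p => Φ (p, q) :=
  .intro (hΦ.isCompact.image continuous_fst) fun p hp =>
    image_eq_zero_of_notMem_tsupport fun h => hp ⟨(p, q), h, rfl⟩

lemma measurable_sign : Measurable Real.sign := by
  unfold Real.sign
  exact Measurable.ite measurableSet_Iio measurable_const
    (Measurable.ite measurableSet_Ioi measurable_const measurable_const)

lemma abs_sign_le (x : ℝ) : |Real.sign x| ≤ 1 := by
  rcases Real.sign_apply_eq x with h | h | h <;> simp [h]

lemma abs_sub_le_add_of_abs_le {a b M N : ℝ} (ha : |a| ≤ M) (hb : |b| ≤ N) : |a - b| ≤ M + N :=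
  (abs_sub a b).trans (add_le_add ha hb)

lemma abs_image_sub_le_of_abs_le {A : ℝ → ℝ} {LA : ℝ≥0} (hA : LipschitzWith LA A) {a b M N : ℝ}
    (ha : |a| ≤ M) (hb : |b| ≤ N) : |A a - A b| ≤ LA * (M + N) :=
  (hA.norm_sub_le a b).trans
    (mul_le_mul_of_nonneg_left (abs_sub_le_add_of_abs_le ha hb) LA.2)

lemma abs_symmJumpOp_smallJumps_le {E F : Type*} [NormedAddCommGroup E] [MeasurableSpace E]
    [BorelSpace E] [NormedAddCommGroup F] {ν : Measure E} (hν : IsLevyMeasure ν) {τ : E → F}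
    (hτ : ∀ z, ‖τ z‖ = ‖z‖) {w : F → ℝ} {C : ℝ} {K : Set F}
    (hC : ∀ p h, ‖h‖ ≤ 1 → |secondDiff w p h| ≤ K.indicator (fun _ => C * ‖h‖ ^ 2) p)
    {r : ℝ} (hr : r ≤ 1) (p : F) :
    |symmJumpOp (smallJumps ν r) τ w p| ≤
      K.indicator (fun _ => C * ∫ z, ‖z‖ ^ 2 ∂(smallJumps ν r)) p := by
  have hbound : ∀ᵐ z ∂(smallJumps ν r),
      ‖secondDiff w p (τ z)‖ ≤ K.indicator (fun _ => C * ‖z‖ ^ 2) p := by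
    refine (ae_restrict_iff' (measurableSet_norm_lt r)).2 (ae_of_all _ fun z (hz : ‖z‖ < r) => ?_)
    simpa only [hτ, Real.norm_eq_abs] using hC p (τ z) ((hτ z).trans_le (hz.le.trans hr))
  by_cases hp : p ∈ K
  · simp only [indicator_of_mem hp] at hbound ⊢
    rw [← integral_const_mul]
    exact norm_integral_le_of_norm_le ((hν.integrable_norm_sq_smallJumps r).const_mul C) hbound
  · simp only [indicator_of_notMem hp] at hbound ⊢
    rw [symmJumpOp, integral_eq_zero_of_ae (hbound.mono fun z => norm_le_zero_iff.1), abs_zero]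

end Bounds

section Flux

variable {d : ℕ} {f : ℝ → Space d} {Lf : ℝ≥0}

lemma fluxVec_comm (f : ℝ → Space d) (k u : ℝ) : fluxVec f k u = fluxVec f u k := by
  have hsign : Real.sign (k - u) = -Real.sign (u - k) := by rw [← Real.sign_neg, neg_sub]
  simp only [fluxVec, flux, eta, eta', abs_sub_comm u k, hsign, neg_smul, ← smul_neg, neg_sub]

lemma norm_fluxVec_le (hf : LipschitzWith Lf f) (k u : ℝ) :
    ‖fluxVec f k u‖ ≤ (Lf + 1) * |u - k| := by
  refine norm_prod_le_iff.2 ⟨?_, ?_⟩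
  · calc ‖flux f k u‖ = |Real.sign (u - k)| * ‖f u - f k‖ := norm_smul _ _
      _ ≤ 1 * (Lf * |u - k|) :=
        mul_le_mul (abs_sign_le _) (hf.norm_sub_le u k) (norm_nonneg _) zero_le_one
      _ ≤ (Lf + 1) * |u - k| := by linarith [abs_nonneg (u - k)]
  · calc ‖eta k u‖ = |u - k| := abs_abs _
      _ ≤ (Lf + 1) * |u - k| := le_mul_of_one_le_left (abs_nonneg _) (by simp)

lemma norm_fluxVec_le_of_abs_le (hf : LipschitzWith Lf f) {M N a b : ℝ} (ha : |a| ≤ M)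
    (hb : |b| ≤ N) : ‖fluxVec f b a‖ ≤ (Lf + 1) * (M + N) :=
  (norm_fluxVec_le hf _ _).trans (by gcongr; exact abs_sub_le_add_of_abs_le ha hb)

lemma measurable_fluxVec {α : Type*} [MeasurableSpace α] (hf : Continuous f)
    {g h : α → ℝ} (hg : Measurable g) (hh : Measurable h) :
    Measurable fun a => fluxVec f (g a) (h a) := by
  have hsign : Measurable fun a => Real.sign (h a - g a) := measurable_sign.comp (hh.sub hg)
  have hdiff : Measurable fun a => f (h a) - f (g a) :=
    (hf.measurable.comp hh).sub (hf.measurable.comp hg)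
  exact (hsign.smul hdiff).prodMk (hh.sub hg).norm

end Flux

instance isAddHaarMeasure_spaceTime (d : ℕ) :
    (volume : Measure (SpaceTime d)).IsAddHaarMeasure := by
  rw [Measure.volume_eq_prod]; infer_instance

instance isAddHaarMeasure_doubled (d : ℕ) :
    (volume : Measure (SpaceTime d × SpaceTime d)).IsAddHaarMeasure :=
  Measure.prod.instIsAddHaarMeasure _ _

section Doubling

variable {d : ℕ}

/-- The shift of the first of two space-time points by a jump in space. -/
def shiftFst (z : Space d) : SpaceTime d × SpaceTime d := (spaceShift z, 0)

lemma measurable_shiftFst : Measurable (shiftFst (d := d)) :=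
  measurable_spaceShift.prodMk measurable_const

lemma norm_shiftFst (z : Space d) : ‖shiftFst z‖ = ‖z‖ := by simp [shiftFst]

/-- The regular part of the integrand of the entropy inequality for `U` with `k = V q`, as a
function of both variables. -/
def doublingIntegrand (ν : Measure (Space d)) (f : ℝ → Space d) (A : ℝ → ℝ)
    (U V : SpaceTime d → ℝ) (r : ℝ) (Φ : SpaceTime d × SpaceTime d → ℝ)
    (a : SpaceTime d × SpaceTime d) : ℝ :=
  fderiv ℝ Φ a (fluxVec f (V a.2) (U a.1), 0) +
    Real.sign (U a.1 - V a.2) * jumpOp (largeJumps ν r) spaceShift (A ∘ U) a.1 * Φ a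

/-- The distance of `A(U)` and `A(V)` as a function of both variables. -/
def doubledDist (A : ℝ → ℝ) (U V : SpaceTime d → ℝ) (a : SpaceTime d × SpaceTime d) : ℝ :=
  |A (U a.1) - A (V a.2)|

/-- The singular part of the integrand of the entropy inequality for `U` with `k = V q`, as a
function of both variables. -/
def singularIntegrand (ν : Measure (Space d)) (A : ℝ → ℝ) (U V : SpaceTime d → ℝ) (r : ℝ)
    (Φ : SpaceTime d × SpaceTime d → ℝ) (a : SpaceTime d × SpaceTime d) : ℝ :=
  doubledDist A U V a * symmJumpOp (smallJumps ν r) shiftFst Φ a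

variable {ν : Measure (Space d)} {T : ℝ} {f : ℝ → Space d} {Lf : ℝ≥0} {A : ℝ → ℝ} {LA : ℝ≥0}
  {U V : SpaceTime d → ℝ} {M N : ℝ} {Φ : SpaceTime d × SpaceTime d → ℝ}

lemma kruzkovIntegrand_slice (hΦ : Differentiable ℝ Φ) (r : ℝ) (p q : SpaceTime d) :
    kruzkovIntegrand ν f A U (V q) r (fun p => Φ (p, q)) p =
      doublingIntegrand ν f A U V r Φ (p, q) + singularIntegrand ν A U V r Φ (p, q) := by
  have hslice : symmJumpOp (smallJumps ν r) spaceShift (fun p => Φ (p, q)) p =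
      symmJumpOp (smallJumps ν r) shiftFst Φ (p, q) := by
    simp [symmJumpOp, secondDiff, shiftFst]
  rw [kruzkovIntegrand, doublingIntegrand, singularIntegrand, doubledDist,
    fderiv_slice_fst hΦ, hslice]
  ring

lemma abs_sign_mul_jumpOp_le {m : Measure (Space d)} [IsFiniteMeasure m]
    (hA : LipschitzWith LA A) (hM : ∀ p, |U p| ≤ M) (s : ℝ) (p : SpaceTime d) :
    |Real.sign s * jumpOp m spaceShift (A ∘ U) p| ≤ LA * (M + M) * m.real univ := by
  have hjump : |jumpOp m spaceShift (A ∘ U) p| ≤ LA * (M + M) * m.real univ :=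
    abs_jumpOp_le fun q => abs_image_sub_le_of_abs_le hA (hM q) (hM p)
  rw [abs_mul]
  exact (mul_le_of_le_one_left (abs_nonneg _) (abs_sign_le s)).trans hjump

lemma measurable_doubledDist (hA : Continuous A) (hU : Measurable U) (hV : Measurable V) :
    Measurable (doubledDist A U V) :=
  ((hA.measurable.comp (hU.comp measurable_fst)).sub
    (hA.measurable.comp (hV.comp measurable_snd))).norm

lemma abs_doubledDist_le (hA : LipschitzWith LA A) (hM : ∀ p, |U p| ≤ M) (hN : ∀ p, |V p| ≤ N)
    (a : SpaceTime d × SpaceTime d) : |doubledDist A U V a| ≤ LA * (M + N) :=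
  (abs_abs _).trans_le (abs_image_sub_le_of_abs_le hA (hM a.1) (hN a.2))

variable (hν : IsLevyMeasure ν) (hA : LipschitzWith LA A) (hM : ∀ p, |U p| ≤ M)
  (hN : ∀ p, |V p| ≤ N) (hΦ : ContDiff ℝ ∞ Φ) (hΦc : HasCompactSupport Φ)
include hν hA hM hN hΦ hΦc

lemma exists_abs_singularIntegrand_le :
    ∃ (C : ℝ) (K : Set (SpaceTime d × SpaceTime d)), IsCompact K ∧
      ∀ r ≤ 1, ∀ a, |singularIntegrand ν A U V r Φ a| ≤
        K.indicator (fun _ => C * ∫ z, ‖z‖ ^ 2 ∂(smallJumps ν r)) a := by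
  obtain ⟨C, K, hK, hC⟩ := exists_abs_secondDiff_le_indicator hΦ hΦc
  refine ⟨LA * (M + N) * C, K, hK, fun r hr a => ?_⟩
  have hAUV := abs_doubledDist_le hA hM hN a
  have hsymm := abs_symmJumpOp_smallJumps_le hν norm_shiftFst hC hr a
  rw [singularIntegrand, abs_mul]
  refine (mul_le_mul hAUV hsymm (abs_nonneg _) ((abs_nonneg _).trans hAUV)).trans_eq ?_
  by_cases ha : a ∈ K
  · simp only [indicator_of_mem ha, mul_assoc]
  · simp only [indicator_of_notMem ha, mul_zero]

lemma tendsto_integral_singularIntegrand :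
    Tendsto (fun r => ∫ a, singularIntegrand ν A U V r Φ a) (𝓝[>] 0) (𝓝 0) := by
  obtain ⟨C, K, hK, hC⟩ := exists_abs_singularIntegrand_le hν hA hM hN hΦ hΦc
  have hlim := (hν.tendsto_integral_norm_sq_smallJumps.const_mul C).const_mul (volume.real K)
  simp only [mul_zero] at hlim
  refine squeeze_zero_norm' ?_ hlim
  filter_upwards [Ioo_mem_nhdsGT one_pos] with r hr
  rw [← smul_eq_mul, ← setIntegral_const, ← integral_indicator hK.measurableSet]
  exact norm_integral_le_of_norm_le ((integrable_indicator_iff hK.measurableSet).2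
    (integrableOn_const hK.measure_lt_top.ne)) (ae_of_all _ (hC r hr.2.le))

variable [SFinite ν] (hU : Measurable U) (hV : Measurable V)
include hU hV

lemma integrable_singularIntegrand {r : ℝ} (hr : r ≤ 1) :
    Integrable (singularIntegrand ν A U V r Φ) := by
  obtain ⟨C, K, hK, hC⟩ := exists_abs_singularIntegrand_le hν hA hM hN hΦ hΦc
  refine ((integrable_indicator_iff hK.measurableSet).2
    (integrableOn_const hK.measure_lt_top.ne)).mono' ?_ (ae_of_all _ (hC r hr))
  exact ((measurable_doubledDist hA.continuous hU hV).mul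
    (measurable_symmJumpOp hΦ.continuous.measurable measurable_shiftFst)).aestronglyMeasurable

lemma integrable_doublingIntegrand (hf : LipschitzWith Lf f) {r : ℝ} (hr : 0 < r) :
    Integrable (doublingIntegrand ν f A U V r Φ) := by
  have := hν.isFiniteMeasure_largeJumps hr
  have hflux : Measurable fun a : SpaceTime d × SpaceTime d =>
      ((fluxVec f (V a.2) (U a.1), 0) : SpaceTime d × SpaceTime d) :=
    (measurable_fluxVec hf.continuous (hV.comp measurable_snd)
      (hU.comp measurable_fst)).prodMk measurable_const
  have hsign : Measurable fun a : SpaceTime d × SpaceTime d => Real.sign (U a.1 - V a.2) :=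
    measurable_sign.comp ((hU.comp measurable_fst).sub (hV.comp measurable_snd))
  have hjump : Measurable fun a : SpaceTime d × SpaceTime d =>
      jumpOp (largeJumps ν r) spaceShift (A ∘ U) a.1 :=
    (measurable_jumpOp (hA.continuous.measurable.comp hU) measurable_spaceShift).comp
      measurable_fst
  refine (integrable_fderiv_apply hΦ hΦc hflux (B := (Lf + 1) * (M + N)) fun a => ?_).add
    (integrable_bounded_mul hΦ.continuous hΦc (hsign.mul hjump)
      fun a => abs_sign_mul_jumpOp_le hA hM _ _)
  rw [Prod.norm_mk, norm_zero, max_eq_left (norm_nonneg _)]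
  exact norm_fluxVec_le_of_abs_le hf (hM _) (hN _)

end Doubling

section Kato

variable {d : ℕ}

/-- The shift of two space-time points by the same jump in space. -/
def shiftDiag (z : Space d) : SpaceTime d × SpaceTime d := (spaceShift z, spaceShift z)

lemma measurable_shiftDiag : Measurable (shiftDiag (d := d)) :=
  measurable_spaceShift.prodMk measurable_spaceShift

lemma shiftDiag_neg (z : Space d) : shiftDiag (-z) = -shiftDiag z := by simp [shiftDiag]

lemma sign_mul_jump_le {A : ℝ → ℝ} (hA : Monotone A) (u v u' v' : ℝ) :
    Real.sign (u - v) * ((A u' - A u) - (A v' - A v)) ≤ |A u' - A v'| - |A u - A v| := by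
  rcases lt_trichotomy u v with h | rfl | h
  · rw [Real.sign_of_neg (sub_neg.2 h), abs_of_nonpos (sub_nonpos.2 (hA h.le))]
    linarith [neg_le_abs (A u' - A v')]
  · simp
  · rw [Real.sign_of_pos (sub_pos.2 h), abs_of_nonneg (sub_nonneg.2 (hA h.le))]
    linarith [le_abs_self (A u' - A v')]

lemma sign_mul_jumpOp_sub_le {m : Measure (Space d)} [IsFiniteMeasure m] {A : ℝ → ℝ} {LA : ℝ≥0}
    (hA : LipschitzWith LA A) (hAmono : Monotone A) {U V : SpaceTime d → ℝ} (hU : Measurable U)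
    (hV : Measurable V) {M N : ℝ} (hM : ∀ p, |U p| ≤ M) (hN : ∀ p, |V p| ≤ N)
    (p q : SpaceTime d) :
    Real.sign (U p - V q) *
        (jumpOp m spaceShift (A ∘ U) p - jumpOp m spaceShift (A ∘ V) q) ≤
      jumpOp m shiftDiag (doubledDist A U V) (p, q) := by
  have hAm := hA.continuous.measurable
  have hintU : Integrable (fun z => (A ∘ U) (p + spaceShift z) - (A ∘ U) p) m :=
    integrable_jump (hAm.comp hU) measurable_spaceShift
      fun _ => abs_image_sub_le_of_abs_le hA (hM _) (hM _)
  have hintV : Integrable (fun z => (A ∘ V) (q + spaceShift z) - (A ∘ V) q) m :=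
    integrable_jump (hAm.comp hV) measurable_spaceShift
      fun _ => abs_image_sub_le_of_abs_le hA (hN _) (hN _)
  have hintD := integrable_jump (m := m) (x := (p, q)) (measurable_doubledDist hA.continuous hU hV)
    measurable_shiftDiag fun _ => abs_sub_le_add_of_abs_le
      (abs_doubledDist_le hA hM hN _) (abs_doubledDist_le hA hM hN _)
  rw [jumpOp, jumpOp, ← integral_sub hintU hintV, ← integral_const_mul]
  exact integral_mono ((hintU.sub hintV).const_mul _) hintD
    fun z => sign_mul_jump_le hAmono (U p) (V q) (U (p + spaceShift z)) (V (q + spaceShift z))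

end Kato

section Doubling

variable {d : ℕ} {ν : Measure (Space d)} {T : ℝ} {f : ℝ → Space d} {Lf : ℝ≥0} {A : ℝ → ℝ}
  {LA : ℝ≥0} {U V : SpaceTime d → ℝ} {M N : ℝ} {Φ : SpaceTime d × SpaceTime d → ℝ}

/-- The Kružkov flux between `U` and `V`, acting in both variables. -/
def doubledFlux (f : ℝ → Space d) (U V : SpaceTime d → ℝ) (a : SpaceTime d × SpaceTime d) :
    SpaceTime d × SpaceTime d :=
  (fluxVec f (V a.2) (U a.1), fluxVec f (V a.2) (U a.1))

lemma integrable_fderiv_doubledFlux (hf : LipschitzWith Lf f) (hU : Measurable U)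
    (hV : Measurable V) (hM : ∀ p, |U p| ≤ M) (hN : ∀ p, |V p| ≤ N)
    (hΦ : ContDiff ℝ ∞ Φ) (hΦc : HasCompactSupport Φ) :
    Integrable fun a => fderiv ℝ Φ a (doubledFlux f U V a) := by
  have hflux : Measurable fun a : SpaceTime d × SpaceTime d => fluxVec f (V a.2) (U a.1) :=
    measurable_fluxVec hf.continuous (hV.comp measurable_snd) (hU.comp measurable_fst)
  refine integrable_fderiv_apply hΦ hΦc (hflux.prodMk hflux) (B := (Lf + 1) * (M + N)) fun a => ?_
  rw [doubledFlux, Prod.norm_mk, max_self]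
  exact norm_fluxVec_le_of_abs_le hf (hM _) (hN _)

lemma fderiv_comp_swap_apply (hΦ : Differentiable ℝ Φ) (p q w : SpaceTime d) :
    fderiv ℝ (Φ ∘ Prod.swap) (q, p) (w, 0) = fderiv ℝ Φ (p, q) (0, w) := by
  have h : HasFDerivAt (Φ ∘ Prod.swap) ((fderiv ℝ Φ (p, q)).comp
      ((ContinuousLinearMap.snd ℝ (SpaceTime d) (SpaceTime d)).prod
        (ContinuousLinearMap.fst ℝ _ _))) (q, p) :=
    (hΦ (p, q)).hasFDerivAt.comp (q, p) (hasFDerivAt_snd.prodMk hasFDerivAt_fst)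
  rw [h.fderiv]
  simp

lemma doublingIntegrand_add_swap_le {r : ℝ} [IsFiniteMeasure (largeJumps ν r)]
    (hA : LipschitzWith LA A) (hAmono : Monotone A) (hU : Measurable U) (hV : Measurable V)
    (hM : ∀ p, |U p| ≤ M) (hN : ∀ p, |V p| ≤ N) (hΦ : Differentiable ℝ Φ) (hΦ0 : ∀ a, 0 ≤ Φ a)
    (a : SpaceTime d × SpaceTime d) :
    doublingIntegrand ν f A U V r Φ a + doublingIntegrand ν f A V U r (Φ ∘ Prod.swap) a.swap ≤
      fderiv ℝ Φ a (doubledFlux f U V a) +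
        jumpOp (largeJumps ν r) shiftDiag (doubledDist A U V) a * Φ a := by
  obtain ⟨p, q⟩ := a
  have hflux : fderiv ℝ Φ (p, q) (doubledFlux f U V (p, q)) =
      fderiv ℝ Φ (p, q) (fluxVec f (V q) (U p), 0) +
        fderiv ℝ (Φ ∘ Prod.swap) (q, p) (fluxVec f (U p) (V q), 0) := by
    rw [fderiv_comp_swap_apply hΦ, fluxVec_comm f (U p), ← map_add]
    simp [doubledFlux]
  have hsign : Real.sign (V q - U p) = -Real.sign (U p - V q) := by rw [← Real.sign_neg, neg_sub]
  have hkato := mul_le_mul_of_nonneg_right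
    (sign_mul_jumpOp_sub_le (m := largeJumps ν r) hA hAmono hU hV hM hN p q) (hΦ0 (p, q))
  simp only [doublingIntegrand, Prod.swap_prod_mk, Function.comp_apply]
  rw [hflux, hsign]
  linarith

lemma integral_doublingIntegrand_add_swap_le [SFinite ν] [ν.IsNegInvariant]
    (hν : IsLevyMeasure ν) (hf : LipschitzWith Lf f) (hA : LipschitzWith LA A)
    (hAmono : Monotone A) (hU : Measurable U) (hV : Measurable V) (hM : ∀ p, |U p| ≤ M)
    (hN : ∀ p, |V p| ≤ N) (hΦ : ContDiff ℝ ∞ Φ) (hΦc : HasCompactSupport Φ)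
    (hΦ0 : ∀ a, 0 ≤ Φ a) {r : ℝ} (hr : 0 < r) :
    (∫ a, doublingIntegrand ν f A U V r Φ a) +
        ∫ a, doublingIntegrand ν f A V U r (Φ ∘ Prod.swap) a ≤
      (∫ a, fderiv ℝ Φ a (doubledFlux f U V a)) +
        ∫ a, doubledDist A U V a * jumpOp (largeJumps ν r) shiftDiag Φ a := by
  have hΨ : ContDiff ℝ ∞ (Φ ∘ Prod.swap) := hΦ.comp (contDiff_snd.prodMk contDiff_fst)
  have hΨc : HasCompactSupport (Φ ∘ Prod.swap) := hΦc.comp_homeomorph (Homeomorph.prodComm _ _)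
  have := hν.isFiniteMeasure_largeJumps hr
  have hD := measurable_doubledDist hA.continuous hU hV
  have hDb := abs_doubledDist_le hA hM hN
  have hintUV := integrable_doublingIntegrand hν hA hM hN hΦ hΦc hU hV hf hr
  have hintVU :=
    (integrable_doublingIntegrand hν hA hN hM hΨ hΨc hV hU hf hr).swap
  have hintF := integrable_fderiv_doubledFlux hf hU hV hM hN hΦ hΦc
  have hintJ : Integrable fun a =>
      jumpOp (largeJumps ν r) shiftDiag (doubledDist A U V) a * Φ a :=
    integrable_bounded_mul hΦ.continuous hΦc (measurable_jumpOp hD measurable_shiftDiag)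
      fun a => abs_jumpOp_le fun b => abs_sub_le_add_of_abs_le (hDb b) (hDb a)
  have htranspose : ∫ a, jumpOp (largeJumps ν r) shiftDiag (doubledDist A U V) a * Φ a =
      ∫ a, doubledDist A U V a * jumpOp (largeJumps ν r) shiftDiag Φ a := by
    rw [integral_jumpOp_mul measurable_shiftDiag hD hDb hΦ.continuous.measurable
      (hΦ.continuous.integrable_of_hasCompactSupport hΦc)]
    simp only [jumpOp_neg shiftDiag_neg]
  have hswap : ∫ a, doublingIntegrand ν f A V U r (Φ ∘ Prod.swap) a =
      ∫ a, (doublingIntegrand ν f A V U r (Φ ∘ Prod.swap) ∘ Prod.swap) a :=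
    (integral_prod_swap _).symm
  have hsum := integral_mono (hintUV.add hintVU) (hintF.add hintJ) fun a =>
    doublingIntegrand_add_swap_le (f := f) hA hAmono hU hV hM hN
      (hΦ.differentiable (by simp)) hΦ0 (r := r) a
  rwa [integral_add' hintUV hintVU, ← hswap, integral_add' hintF hintJ, htranspose] at hsum

end Doubling

namespace IsLevyEntropySolution

variable {d : ℕ} {ν : Measure (Space d)} [SFinite ν] {T : ℝ} {f : ℝ → Space d} {Lf : ℝ≥0}
  {A : ℝ → ℝ} {LA : ℝ≥0} {U V : SpaceTime d → ℝ} {N : ℝ} {Φ : SpaceTime d × SpaceTime d → ℝ}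
  (hν : IsLevyMeasure ν) (hf : LipschitzWith Lf f) (hA : LipschitzWith LA A)
  (hΦ : ContDiff ℝ ∞ Φ) (hΦc : HasCompactSupport Φ) (hΦ0 : ∀ a, 0 ≤ Φ a)
  (hΦ₁ : ∀ q, tsupport (fun p => Φ (p, q)) ⊆ cylinder d T)
include hν hf hA hΦ hΦc hΦ0 hΦ₁

section

variable (hU : IsLevyEntropySolution ν T f A U) (hV : Measurable V) (hN : ∀ p, |V p| ≤ N)
include hU hV hN

lemma integral_doublingIntegrand_add_singularIntegrand_nonneg {r : ℝ} (hr0 : 0 < r) (hr1 : r ≤ 1) :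
    0 ≤ (∫ a, doublingIntegrand ν f A U V r Φ a) + ∫ a, singularIntegrand ν A U V r Φ a := by
  obtain ⟨M, hM⟩ := hU.bounded
  have hreg := integrable_doublingIntegrand hν hA hM hN hΦ hΦc hU.measurable hV hf hr0
  have hsing := integrable_singularIntegrand hν hA hM hN hΦ hΦc hU.measurable hV hr1
  rw [← integral_add' hreg hsing, Measure.volume_eq_prod, integral_prod_symm _ (hreg.add hsing)]
  refine integral_nonneg fun q => ?_
  simp only [Pi.add_apply, ← kruzkovIntegrand_slice (hΦ.differentiable (by simp))]
  exact hU.ineq (V q) r hr0 _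
    ⟨hΦ.comp (by fun_prop), hasCompactSupport_slice_fst hΦc q, hΦ₁ q, fun p => hΦ0 (p, q)⟩

lemma eventually_neg_lt_integral_doublingIntegrand {ε : ℝ} (hε : 0 < ε) :
    ∀ᶠ r in 𝓝[>] 0, -ε < ∫ a, doublingIntegrand ν f A U V r Φ a := by
  obtain ⟨M, hM⟩ := hU.bounded
  have hlim := tendsto_integral_singularIntegrand hν hA hM hN hΦ hΦc
  filter_upwards [hlim.eventually_lt_const hε, Ioo_mem_nhdsGT one_pos] with r hrε hr
  linarith [integral_doublingIntegrand_add_singularIntegrand_nonneg hν hf hA hΦ hΦc hΦ0 hΦ₁ hU hV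
    hN hr.1 hr.2.le]

end

theorem eventually_neg_lt_doubling (hAmono : Monotone A) [ν.IsNegInvariant]
    (hΦ₂ : ∀ p, tsupport (fun q => Φ (p, q)) ⊆ cylinder d T)
    (hU : IsLevyEntropySolution ν T f A U) (hV : IsLevyEntropySolution ν T f A V)
    {ε : ℝ} (hε : 0 < ε) :
    ∀ᶠ r in 𝓝[>] 0, -ε < (∫ a, fderiv ℝ Φ a (doubledFlux f U V a)) +
      ∫ a, doubledDist A U V a * jumpOp (largeJumps ν r) shiftDiag Φ a := by
  obtain ⟨M, hM⟩ := hU.bounded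
  obtain ⟨N, hN⟩ := hV.bounded
  have hΨ : ContDiff ℝ ∞ (Φ ∘ Prod.swap) := hΦ.comp (contDiff_snd.prodMk contDiff_fst)
  have hΨc : HasCompactSupport (Φ ∘ Prod.swap) := hΦc.comp_homeomorph (Homeomorph.prodComm _ _)
  filter_upwards [self_mem_nhdsWithin,
    eventually_neg_lt_integral_doublingIntegrand hν hf hA hΦ hΦc hΦ0 hΦ₁ hU hV.measurable hN
      (half_pos hε),
    eventually_neg_lt_integral_doublingIntegrand hν hf hA hΨ hΨc (fun _ => hΦ0 _) hΦ₂ hV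
      hU.measurable hM (half_pos hε)] with r hr hUV hVU
  have hsum := integral_doublingIntegrand_add_swap_le hν hf hA hAmono hU.measurable hV.measurable
    hM hN hΦ hΦc hΦ0 hr
  linarith

end IsLevyEntropySolution

section Mollified

section AddGroup

variable {G : Type*} [AddCommGroup G] [MeasurableSpace G] [MeasurableAdd₂ G] [MeasurableNeg G]
  {μ : Measure G} [SFinite μ] [μ.IsAddLeftInvariant] {U V ρ : G → ℝ}

lemma integrable_snd_mul_comp_sub (hV : Integrable V μ) (hρ : Integrable ρ μ) :
    Integrable (fun a : G × G => V a.2 * ρ (a.1 - a.2)) (μ.prod μ) :=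
  hV.convolution_integrand (ContinuousLinearMap.mul ℝ ℝ) hρ

variable [μ.IsNegInvariant]

lemma integrable_fst_mul_comp_sub (hU : Integrable U μ) (hρ : Integrable ρ μ) :
    Integrable (fun a : G × G => U a.1 * ρ (a.1 - a.2)) (μ.prod μ) :=
  (integrable_snd_mul_comp_sub hU hρ.comp_neg).swap.congr (ae_of_all _ fun a => by simp)

lemma integrable_abs_sub_mul_comp_sub (hU : Integrable U μ) (hV : Integrable V μ)
    (hρ : Integrable ρ μ) :
    Integrable (fun a : G × G => |U a.1 - V a.2| * ρ (a.1 - a.2)) (μ.prod μ) := by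
  have hmeas : AEStronglyMeasurable (fun a : G × G => |U a.1 - V a.2| * ρ (a.1 - a.2))
      (μ.prod μ) :=
    (hU.1.comp_fst.sub hV.1.comp_snd).norm.mul
      (hρ.1.comp_quasiMeasurePreserving (quasiMeasurePreserving_sub_of_right_invariant μ μ))
  refine ((integrable_fst_mul_comp_sub hU hρ).sub (integrable_snd_mul_comp_sub hV hρ)).mono
    hmeas (ae_of_all _ fun a => ?_)
  rw [Pi.sub_apply, ← sub_mul, norm_mul, norm_mul, Real.norm_eq_abs |_|, abs_abs]
  rfl

end AddGroup

variable {d : ℕ} {U V ρ ψ : SpaceTime d → ℝ}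

/-- The test function `ρ(p - q) ψ(p)`, which forces the two points together. -/
def mollifiedTest (ρ ψ : SpaceTime d → ℝ) (a : SpaceTime d × SpaceTime d) : ℝ :=
  ρ (a.1 - a.2) * ψ a.1

lemma contDiff_mollifiedTest (hρ : ContDiff ℝ ∞ ρ) (hψ : ContDiff ℝ ∞ ψ) :
    ContDiff ℝ ∞ (mollifiedTest ρ ψ) :=
  (hρ.comp (contDiff_fst.sub contDiff_snd)).mul (hψ.comp contDiff_fst)

lemma hasCompactSupport_mollifiedTest (hρ : HasCompactSupport ρ) (hψ : HasCompactSupport ψ) :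
    HasCompactSupport (mollifiedTest ρ ψ) := by
  refine .intro ((hψ.isCompact.prod hρ.isCompact).image
    (f := fun b : SpaceTime d × SpaceTime d => (b.1, b.1 - b.2)) (by fun_prop)) fun a ha => ?_
  by_contra h
  refine ha ⟨(a.1, a.1 - a.2), ⟨?_, ?_⟩, by simp⟩
  · exact subset_tsupport _ (right_ne_zero_of_mul h)
  · exact subset_tsupport _ (left_ne_zero_of_mul h)

lemma tsupport_mollifiedTest_fst_subset (ρ ψ : SpaceTime d → ℝ) (q : SpaceTime d) :
    tsupport (fun p => mollifiedTest ρ ψ (p, q)) ⊆ tsupport ψ :=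
  tsupport_mul_subset_right

lemma tsupport_mollifiedTest_snd_subset {S : Set (SpaceTime d)}
    (hS : ∀ p ∈ tsupport ψ, ∀ h ∈ tsupport ρ, p - h ∈ S) (p : SpaceTime d) :
    tsupport (fun q => mollifiedTest ρ ψ (p, q)) ⊆ S := by
  by_cases hp : p ∈ tsupport ψ
  · have hclosed : IsClosed {q | p - q ∈ tsupport ρ} :=
      (isClosed_tsupport ρ).preimage (by fun_prop)
    refine (closure_minimal (fun q hq => ?_) hclosed).trans fun q hq => ?_
    · exact subset_tsupport _ (left_ne_zero_of_mul hq)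
    · simpa using hS p hp _ hq
  · have hzero : (fun q => mollifiedTest ρ ψ (p, q)) = 0 := by
      ext q
      simp [mollifiedTest, image_eq_zero_of_notMem_tsupport hp]
    rw [hzero, tsupport_zero]
    exact empty_subset _

lemma fderiv_mollifiedTest_diag (hρ : Differentiable ℝ ρ) (hψ : Differentiable ℝ ψ)
    (a : SpaceTime d × SpaceTime d) (w : SpaceTime d) :
    fderiv ℝ (mollifiedTest ρ ψ) a (w, w) = ρ (a.1 - a.2) * fderiv ℝ ψ a.1 w := by
  have hρ' : HasFDerivAt (fun a : SpaceTime d × SpaceTime d => ρ (a.1 - a.2))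
      ((fderiv ℝ ρ (a.1 - a.2)).comp (ContinuousLinearMap.fst ℝ _ _ -
        ContinuousLinearMap.snd ℝ _ _)) a :=
    (hρ _).hasFDerivAt.comp a (hasFDerivAt_fst.sub hasFDerivAt_snd)
  have hψ' : HasFDerivAt (fun a : SpaceTime d × SpaceTime d => ψ a.1)
      ((fderiv ℝ ψ a.1).comp (ContinuousLinearMap.fst ℝ _ _)) a :=
    (hψ _).hasFDerivAt.comp a hasFDerivAt_fst
  have hprod : HasFDerivAt (mollifiedTest ρ ψ) _ a := hρ'.mul hψ'
  rw [hprod.fderiv]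
  simp

lemma jumpOp_shiftDiag_mollifiedTest (m : Measure (Space d)) (a : SpaceTime d × SpaceTime d) :
    jumpOp m shiftDiag (mollifiedTest ρ ψ) a = ρ (a.1 - a.2) * jumpOp m spaceShift ψ a.1 := by
  simp only [jumpOp, mollifiedTest, shiftDiag, Prod.fst_add, Prod.snd_add,
    add_sub_add_right_eq_sub, ← mul_sub, integral_const_mul]

lemma abs_jumpOp_largeJumps_le {ν : Measure (Space d)} [ν.IsNegInvariant] (hν : IsLevyMeasure ν)
    (hψ : Continuous ψ) (hψc : HasCompactSupport ψ) {κ : Space d → ℝ} (hκ : Integrable κ ν)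
    (hψκ : ∀ p z, |secondDiff ψ p (spaceShift z)| ≤ κ z) {r : ℝ} (hr : 0 < r)
    (p : SpaceTime d) : |jumpOp (largeJumps ν r) spaceShift ψ p| ≤ ∫ z, κ z ∂ν := by
  have := hν.isFiniteMeasure_largeJumps hr
  obtain ⟨B, hB⟩ := hψc.exists_bound_of_continuous hψ
  have hκ0 : ∀ z, 0 ≤ κ z := fun z => (abs_nonneg _).trans (hψκ 0 z)
  rw [jumpOp_eq_symmJumpOp spaceShift_neg (integrable_jump hψ.measurable measurable_spaceShift
    fun q => abs_sub_le_add_of_abs_le (hB q) (hB p))]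
  exact (norm_integral_le_of_norm_le (f := fun z => secondDiff ψ p (spaceShift z))
    hκ.integrableOn (ae_of_all _ fun z => hψκ p z)).trans
    (setIntegral_le_integral hκ (ae_of_all _ hκ0))

variable {A : ℝ → ℝ} {LA : ℝ≥0}

lemma integrable_doubledDist_mul_comp_sub (hA : LipschitzWith LA A) (hU : Integrable U)
    (hV : Integrable V) (hUm : Measurable U) (hVm : Measurable V) (hρ : Integrable ρ)
    (hρm : Measurable ρ) : Integrable fun a => doubledDist A U V a * ρ (a.1 - a.2) := by
  refine ((integrable_abs_sub_mul_comp_sub hU hV hρ).norm.const_mul (LA : ℝ)).mono'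
    ((measurable_doubledDist hA.continuous hUm hVm).mul (by fun_prop)).aestronglyMeasurable
    (ae_of_all _ fun a => ?_)
  rw [norm_mul, norm_mul, ← mul_assoc]
  gcongr
  simpa [doubledDist] using hA.norm_sub_le (U a.1) (V a.2)

lemma integral_doubledDist_mul_jumpOp_mollifiedTest_le {ν : Measure (Space d)}
    [ν.IsNegInvariant] (hν : IsLevyMeasure ν)
    (hD : Integrable fun a => doubledDist A U V a * ρ (a.1 - a.2)) (hρ0 : ∀ p, 0 ≤ ρ p)
    (hψ : Continuous ψ) (hψc : HasCompactSupport ψ) {κ : Space d → ℝ} (hκ : Integrable κ ν)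
    (hψκ : ∀ p z, |secondDiff ψ p (spaceShift z)| ≤ κ z) {r : ℝ} (hr : 0 < r) :
    ∫ a, doubledDist A U V a * jumpOp (largeJumps ν r) shiftDiag (mollifiedTest ρ ψ) a ≤
      (∫ z, κ z ∂ν) * ∫ a, doubledDist A U V a * ρ (a.1 - a.2) := by
  rw [← integral_const_mul]
  refine (Real.le_norm_self _).trans
    (norm_integral_le_of_norm_le (hD.const_mul _) (ae_of_all _ fun a => ?_))
  have hweight : 0 ≤ doubledDist A U V a * ρ (a.1 - a.2) := mul_nonneg (abs_nonneg _) (hρ0 _)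
  rw [jumpOp_shiftDiag_mollifiedTest, ← mul_assoc, norm_mul, Real.norm_of_nonneg hweight, mul_comm]
  exact mul_le_mul_of_nonneg_right (abs_jumpOp_largeJumps_le hν hψ hψc hκ hψκ hr a.1) hweight

theorem IsLevyEntropySolution.mollified_doubling {ν : Measure (Space d)} [SFinite ν]
    [ν.IsNegInvariant] {T : ℝ} {f : ℝ → Space d} {Lf : ℝ≥0} (hν : IsLevyMeasure ν)
    (hf : LipschitzWith Lf f) (hA : LipschitzWith LA A) (hAmono : Monotone A)
    (hU : IsLevyEntropySolution ν T f A U) (hV : IsLevyEntropySolution ν T f A V)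
    (hρ : ContDiff ℝ ∞ ρ) (hρc : HasCompactSupport ρ) (hρ0 : ∀ p, 0 ≤ ρ p)
    (hψ : IsNonnegTest T ψ) (hsupp : ∀ p ∈ tsupport ψ, ∀ h ∈ tsupport ρ, p - h ∈ cylinder d T)
    {κ : Space d → ℝ} (hκ : Integrable κ ν)
    (hψκ : ∀ p z, |secondDiff ψ p (spaceShift z)| ≤ κ z) :
    0 ≤ (∫ a : SpaceTime d × SpaceTime d,
        ρ (a.1 - a.2) * fderiv ℝ ψ a.1 (fluxVec f (V a.2) (U a.1))) +
      (∫ z, κ z ∂ν) * ∫ a, doubledDist A U V a * ρ (a.1 - a.2) := by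
  have hD := integrable_doubledDist_mul_comp_sub hA hU.integrable hV.integrable hU.measurable
    hV.measurable (hρ.continuous.integrable_of_hasCompactSupport hρc) hρ.continuous.measurable
  refine le_of_forall_pos_lt_add fun ε hε => ?_
  have hdoubling := hU.eventually_neg_lt_doubling hν hf hA (contDiff_mollifiedTest hρ hψ.smooth)
    (hasCompactSupport_mollifiedTest hρc hψ.compact)
    (fun a => mul_nonneg (hρ0 _) (hψ.nonneg _))
    (fun q => (tsupport_mollifiedTest_fst_subset ρ ψ q).trans hψ.support_subset) hAmono
    (tsupport_mollifiedTest_snd_subset hsupp) hV hε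
  obtain ⟨r, hr, hr0⟩ := (hdoubling.and self_mem_nhdsWithin).exists
  simp only [doubledFlux, fderiv_mollifiedTest_diag (hρ.differentiable (by simp))
    (hψ.smooth.differentiable (by simp))] at hr
  linarith [integral_doubledDist_mul_jumpOp_mollifiedTest_le hν hD hρ0 hψ.smooth.continuous
    hψ.compact hκ hψκ hr0]

end Mollified

section Cutoff

variable {d : ℕ} {T : ℝ} {Θ : ℝ → ℝ} {χ : Space d → ℝ}

/-- A profile `χ` in space at scale `1/ε` times a function of time. -/
def cutoff (χ : Space d → ℝ) (Θ : ℝ → ℝ) (ε : ℝ) (p : SpaceTime d) : ℝ := χ (ε • p.1) * Θ p.2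

lemma tsupport_cutoff_subset (χ : Space d → ℝ) (Θ : ℝ → ℝ) (ε : ℝ) :
    tsupport (cutoff χ Θ ε) ⊆ univ ×ˢ tsupport Θ :=
  closure_minimal (fun _ hp => ⟨mem_univ _, subset_tsupport _ (right_ne_zero_of_mul hp)⟩)
    (isClosed_univ.prod (isClosed_tsupport Θ))

lemma contDiff_cutoff (hχ : ContDiff ℝ ∞ χ) (hΘ : ContDiff ℝ ∞ Θ) (ε : ℝ) :
    ContDiff ℝ ∞ (cutoff χ Θ ε) := by
  unfold cutoff
  fun_prop

lemma isNonnegTest_cutoff (hχ : ContDiff ℝ ∞ χ) (hχc : HasCompactSupport χ) (hχ0 : ∀ x, 0 ≤ χ x)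
    (hΘ : ContDiff ℝ ∞ Θ) (hΘc : HasCompactSupport Θ) (hΘ0 : ∀ t, 0 ≤ Θ t)
    (hΘs : tsupport Θ ⊆ Ioo 0 T) {ε : ℝ} (hε : 0 < ε) : IsNonnegTest T (cutoff χ Θ ε) where
  smooth := contDiff_cutoff hχ hΘ ε
  compact := by
    refine .intro ((hχc.isCompact.prod hΘc.isCompact).image
      (f := fun b : SpaceTime d => (ε⁻¹ • b.1, b.2)) (by fun_prop)) fun p hp => ?_
    by_contra h
    refine hp ⟨(ε • p.1, p.2), ⟨subset_tsupport _ (left_ne_zero_of_mul h),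
      subset_tsupport _ (right_ne_zero_of_mul h)⟩, ?_⟩
    simp [smul_smul, inv_mul_cancel₀ hε.ne']
  support_subset := (tsupport_cutoff_subset χ Θ ε).trans (prod_mono subset_rfl hΘs)
  nonneg _ := mul_nonneg (hχ0 _) (hΘ0 _)

lemma secondDiff_cutoff (χ : Space d → ℝ) (Θ : ℝ → ℝ) (ε : ℝ) (p : SpaceTime d) (z : Space d) :
    secondDiff (cutoff χ Θ ε) p (spaceShift z) = Θ p.2 * secondDiff χ (ε • p.1) (ε • z) := by
  simp only [secondDiff, cutoff, spaceShift, Prod.fst_add, Prod.snd_add, Prod.fst_sub,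
    Prod.snd_sub, add_zero, sub_zero, smul_add, smul_sub]
  ring

lemma exists_abs_secondDiff_cutoff_le (hχ : ContDiff ℝ ∞ χ) (hχc : HasCompactSupport χ)
    (hΘ : Continuous Θ) (hΘc : HasCompactSupport Θ) :
    ∃ C, ∀ ε p z, |secondDiff (cutoff χ Θ ε) p (spaceShift z)| ≤ C * min 1 (‖ε • z‖ ^ 2) := by
  obtain ⟨C, hC⟩ := exists_abs_secondDiff_le_min hχ hχc
  obtain ⟨B, hB⟩ := hΘc.exists_bound_of_continuous hΘ
  refine ⟨B * C, fun ε p z => ?_⟩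
  rw [secondDiff_cutoff, abs_mul, mul_assoc]
  exact mul_le_mul (hB _) (hC _ _) (abs_nonneg _) ((norm_nonneg _).trans (hB p.2))

lemma fderiv_cutoff (hχ : Differentiable ℝ χ) (hΘ : Differentiable ℝ Θ) (ε : ℝ)
    (p w : SpaceTime d) : fderiv ℝ (cutoff χ Θ ε) p w =
      ε * Θ p.2 * fderiv ℝ χ (ε • p.1) w.1 + χ (ε • p.1) * (deriv Θ p.2 * w.2) := by
  have hspace : HasFDerivAt (fun p : SpaceTime d => χ (ε • p.1))
      ((fderiv ℝ χ (ε • p.1)).comp (ε • ContinuousLinearMap.fst ℝ _ _)) p :=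
    (hχ _).hasFDerivAt.comp p (hasFDerivAt_fst.const_smul ε)
  have htime : HasFDerivAt (fun p : SpaceTime d => Θ p.2)
      ((fderiv ℝ Θ p.2).comp (ContinuousLinearMap.snd ℝ _ _)) p :=
    (hΘ _).hasFDerivAt.comp p hasFDerivAt_snd
  have hprod : HasFDerivAt (cutoff χ Θ ε) _ p := hspace.mul htime
  rw [hprod.fderiv]
  simp only [ContinuousLinearMap.comp_smulₛₗ, Real.ringHom_apply, add_apply, smul_apply,
    ContinuousLinearMap.comp_apply, ContinuousLinearMap.coe_snd', fderiv_eq_smul_deriv, smul_eq_mul,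
    ContinuousLinearMap.coe_fst']
  ring

lemma tendsto_fderiv_cutoff (hχ : ContDiff ℝ ∞ χ) (hΘ : Differentiable ℝ Θ)
    (p w : SpaceTime d) :
    Tendsto (fun ε => fderiv ℝ (cutoff χ Θ ε) p w) (𝓝 0) (𝓝 (χ 0 * (deriv Θ p.2 * w.2))) := by
  simp only [fderiv_cutoff (hχ.differentiable (by simp)) hΘ]
  have hfderiv : Continuous (fderiv ℝ χ) := hχ.continuous_fderiv (by simp)
  have hcont : Continuous fun ε : ℝ =>
      ε * Θ p.2 * fderiv ℝ χ (ε • p.1) w.1 + χ (ε • p.1) * (deriv Θ p.2 * w.2) := by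
    have := hχ.continuous
    fun_prop
  simpa using hcont.tendsto 0

lemma exists_abs_fderiv_cutoff_le (hχ : ContDiff ℝ ∞ χ) (hχc : HasCompactSupport χ)
    (hΘ : ContDiff ℝ ∞ Θ) (hΘc : HasCompactSupport Θ) :
    ∃ K, ∀ ε, |ε| ≤ 1 → ∀ p w, |fderiv ℝ (cutoff χ Θ ε) p w| ≤ K * ‖w‖ := by
  obtain ⟨B, hB⟩ := hχc.exists_bound_of_continuous hχ.continuous
  obtain ⟨B', hB'⟩ := (hχc.fderiv ℝ).exists_bound_of_continuous (hχ.continuous_fderiv (by simp))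
  obtain ⟨D, hD⟩ := hΘc.exists_bound_of_continuous hΘ.continuous
  obtain ⟨D', hD'⟩ := hΘc.deriv.exists_bound_of_continuous (hΘ.continuous_deriv (by simp))
  have hB0 : 0 ≤ B := (norm_nonneg _).trans (hB 0)
  have hB'0 : 0 ≤ B' := (norm_nonneg _).trans (hB' 0)
  have hD0 : 0 ≤ D := (norm_nonneg _).trans (hD 0)
  have hD'0 : 0 ≤ D' := (norm_nonneg _).trans (hD' 0)
  refine ⟨D * B' + B * D', fun ε hε p w => ?_⟩
  have hspace : |fderiv ℝ χ (ε • p.1) w.1| ≤ B' * ‖w‖ :=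
    ((fderiv ℝ χ (ε • p.1)).le_opNorm _).trans (by gcongr; exacts [hB' _, norm_fst_le w])
  rw [fderiv_cutoff (hχ.differentiable (by simp)) (hΘ.differentiable (by simp))]
  calc |ε * Θ p.2 * fderiv ℝ χ (ε • p.1) w.1 + χ (ε • p.1) * (deriv Θ p.2 * w.2)|
      ≤ |ε| * |Θ p.2| * |fderiv ℝ χ (ε • p.1) w.1| + |χ (ε • p.1)| * (|deriv Θ p.2| * |w.2|) := by
        simpa only [abs_mul] using abs_add_le (ε * Θ p.2 * fderiv ℝ χ (ε • p.1) w.1)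
          (χ (ε • p.1) * (deriv Θ p.2 * w.2))
    _ ≤ 1 * D * (B' * ‖w‖) + B * (D' * ‖w‖) := by
        gcongr
        exacts [hD _, hB _, hD' _, norm_snd_le w]
    _ = (D * B' + B * D') * ‖w‖ := by ring

lemma tendsto_integral_fderiv_cutoff {X : Type*} [MeasurableSpace X] {μ : Measure X}
    {π F : X → SpaceTime d} (hχ : ContDiff ℝ ∞ χ) (hχc : HasCompactSupport χ)
    (hΘ : ContDiff ℝ ∞ Θ) (hΘc : HasCompactSupport Θ) (hπ : Measurable π) (hF : Integrable F μ) :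
    Tendsto (fun ε => ∫ a, fderiv ℝ (cutoff χ Θ ε) (π a) (F a) ∂μ) (𝓝 0)
      (𝓝 (∫ a, χ 0 * (deriv Θ (π a).2 * (F a).2) ∂μ)) := by
  obtain ⟨K, hK⟩ := exists_abs_fderiv_cutoff_le hχ hχc hΘ hΘc
  refine tendsto_integral_filter_of_dominated_convergence (fun a => K * ‖F a‖)
    (.of_forall fun ε => ?_) ?_ (hF.norm.const_mul K)
    (ae_of_all _ fun a => tendsto_fderiv_cutoff hχ (hΘ.differentiable (by simp)) _ _)
  · have hcont : Continuous (fderiv ℝ (cutoff χ Θ ε)) :=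
      (contDiff_cutoff hχ hΘ ε).continuous_fderiv (by simp)
    exact isBoundedBilinearMap_apply.continuous.comp_aestronglyMeasurable
      ((hcont.stronglyMeasurable.comp_measurable hπ).aestronglyMeasurable.prodMk hF.1)
  · filter_upwards [Metric.closedBall_mem_nhds (0 : ℝ) one_pos] with ε hε
    exact ae_of_all _ fun a => hK ε (mem_closedBall_zero_iff.1 hε) _ _

end Cutoff

lemma min_one_norm_smul_sq_le {E : Type*} [NormedAddCommGroup E] [NormedSpace ℝ E] {ε : ℝ}
    (hε : |ε| ≤ 1) (z : E) : min 1 (‖ε • z‖ ^ 2) ≤ min 1 (‖z‖ ^ 2) := by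
  gcongr
  rw [norm_smul]
  exact mul_le_of_le_one_left (norm_nonneg z) hε

namespace IsLevyMeasure

variable {E : Type*} [NormedAddCommGroup E] [NormedSpace ℝ E] [MeasurableSpace E] [BorelSpace E]
  {ν : Measure E}

lemma integrable_min_norm_smul (hν : IsLevyMeasure ν) {ε : ℝ} (hε : |ε| ≤ 1) :
    Integrable (fun z => min 1 (‖ε • z‖ ^ 2)) ν :=
  hν.integrable_min.mono' (by fun_prop : Measurable _).aestronglyMeasurable
    (ae_of_all _ fun z => by
      rw [Real.norm_of_nonneg (by positivity)]
      exact min_one_norm_smul_sq_le hε z)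

lemma tendsto_integral_min_norm_smul (hν : IsLevyMeasure ν) :
    Tendsto (fun ε : ℝ => ∫ z, min 1 (‖ε • z‖ ^ 2) ∂ν) (𝓝 0) (𝓝 0) := by
  suffices h : Tendsto (fun ε : ℝ => ∫ z, min 1 (‖ε • z‖ ^ 2) ∂ν) (𝓝 0) (𝓝 (∫ _, 0 ∂ν)) by
    rwa [integral_zero] at h
  refine tendsto_integral_filter_of_dominated_convergence _
    (.of_forall fun ε => (by fun_prop : Measurable _).aestronglyMeasurable) ?_ hν.integrable_min
    (ae_of_all _ fun z => ?_)
  · filter_upwards [Metric.closedBall_mem_nhds (0 : ℝ) one_pos] with ε hε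
    refine ae_of_all _ fun z => ?_
    rw [Real.norm_of_nonneg (by positivity)]
    exact min_one_norm_smul_sq_le (mem_closedBall_zero_iff.1 hε) z
  · have hcont : Continuous fun ε : ℝ => min 1 (‖ε • z‖ ^ 2) := by fun_prop
    simpa using hcont.tendsto 0

end IsLevyMeasure

section SpaceLimit

variable {d : ℕ} {T : ℝ} {f : ℝ → Space d} {Lf : ℝ≥0} {A : ℝ → ℝ} {LA : ℝ≥0}
  {U V ρ : SpaceTime d → ℝ} {Θ : ℝ → ℝ}

lemma integrable_mul_fluxVec (hf : LipschitzWith Lf f) (hU : Integrable U) (hV : Integrable V)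
    (hUm : Measurable U) (hVm : Measurable V) (hρ : Integrable ρ) (hρm : Measurable ρ) :
    Integrable fun a : SpaceTime d × SpaceTime d =>
      ρ (a.1 - a.2) • fluxVec f (V a.2) (U a.1) := by
  refine ((integrable_abs_sub_mul_comp_sub hU hV hρ).norm.const_mul (Lf + 1 : ℝ)).mono'
    ?_ (ae_of_all _ fun a => ?_)
  · exact ((hρm.comp (measurable_fst.sub measurable_snd)).smul (measurable_fluxVec hf.continuous
      (hVm.comp measurable_snd) (hUm.comp measurable_fst))).aestronglyMeasurable
  · rw [norm_smul, norm_mul, Real.norm_eq_abs |_|, abs_abs, mul_comm, ← mul_assoc]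
    gcongr
    exact norm_fluxVec_le hf _ _

theorem IsLevyEntropySolution.integral_deriv_mul_mollified_nonneg {ν : Measure (Space d)}
    [SFinite ν] [ν.IsNegInvariant] (hν : IsLevyMeasure ν) (hf : LipschitzWith Lf f)
    (hA : LipschitzWith LA A) (hAmono : Monotone A) (hU : IsLevyEntropySolution ν T f A U)
    (hV : IsLevyEntropySolution ν T f A V) (hρ : ContDiff ℝ ∞ ρ) (hρc : HasCompactSupport ρ)
    (hρ0 : ∀ p, 0 ≤ ρ p) (hΘ : ContDiff ℝ ∞ Θ) (hΘc : HasCompactSupport Θ) (hΘ0 : ∀ t, 0 ≤ Θ t)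
    (hΘs : tsupport Θ ⊆ Ioo 0 T)
    (hsupp : ∀ t ∈ tsupport Θ, ∀ h ∈ tsupport ρ, t - h.2 ∈ Ioo 0 T) :
    0 ≤ ∫ a : SpaceTime d × SpaceTime d, deriv Θ a.1.2 * (|U a.1 - V a.2| * ρ (a.1 - a.2)) := by
  let χ : ContDiffBump (0 : Space d) := ⟨1, 2, one_pos, one_lt_two⟩
  have hχ : ContDiff ℝ ∞ χ := χ.contDiff
  obtain ⟨C, hC⟩ := exists_abs_secondDiff_cutoff_le hχ χ.hasCompactSupport hΘ.continuous hΘc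
  have hflux := tendsto_integral_fderiv_cutoff hχ χ.hasCompactSupport hΘ hΘc measurable_fst
    (integrable_mul_fluxVec hf hU.integrable hV.integrable hU.measurable hV.measurable
      (hρ.continuous.integrable_of_hasCompactSupport hρc) hρ.continuous.measurable)
  have hjump := (hν.tendsto_integral_min_norm_smul.const_mul C).mul_const
    (∫ a, doubledDist A U V a * ρ (a.1 - a.2))
  have hlim := (hflux.add hjump).mono_left (nhdsWithin_le_nhds (s := Ioi 0))
  rw [mul_zero, zero_mul, add_zero] at hlim
  have hlimit : ∫ a : SpaceTime d × SpaceTime d,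
        χ 0 * (deriv Θ a.1.2 * (ρ (a.1 - a.2) • fluxVec f (V a.2) (U a.1)).2) =
      ∫ a : SpaceTime d × SpaceTime d, deriv Θ a.1.2 * (|U a.1 - V a.2| * ρ (a.1 - a.2)) := by
    rw [χ.one_of_mem_closedBall (Metric.mem_closedBall_self χ.rIn_pos.le)]
    simp only [one_mul, fluxVec, Prod.smul_mk, eta, smul_eq_mul, mul_comm (ρ _)]
  rw [← hlimit]
  refine ge_of_tendsto hlim ?_
  filter_upwards [Ioo_mem_nhdsGT one_pos] with ε hε
  have hε1 : |ε| ≤ 1 := (abs_of_pos hε.1).trans_le hε.2.le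
  have hdoubling := hU.mollified_doubling hν hf hA hAmono hV hρ hρc hρ0
    (isNonnegTest_cutoff hχ χ.hasCompactSupport (fun _ => χ.nonneg) hΘ hΘc hΘ0 hΘs hε.1)
    (fun p hp h hh => ⟨mem_univ _, hsupp _ (tsupport_cutoff_subset _ _ _ hp).2 h hh⟩)
    ((hν.integrable_min_norm_smul hε1).const_mul C) (hC ε)
  simpa only [map_smul, smul_eq_mul, integral_const_mul] using hdoubling

end SpaceLimit

section ApproximateIdentity

variable {G ι : Type*} [NormedAddCommGroup G] [SecondCountableTopology G] [MeasurableSpace G]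
  [BorelSpace G] {μ : Measure G} [SFinite μ] [μ.IsAddLeftInvariant] [μ.IsNegInvariant]
  {l : Filter ι} {φ : ι → G → ℝ} {g : G → ℝ} {x₀ : G}

lemma tendsto_integral_mul_of_tendsto_support (hφ0 : ∀ᶠ i in l, ∀ x, 0 ≤ φ i x)
    (hφ1 : ∀ᶠ i in l, ∫ x, φ i x ∂μ = 1)
    (hφs : Tendsto (fun i => Function.support (φ i)) l (𝓝 x₀).smallSets) (hg : Continuous g) :
    Tendsto (fun i => ∫ x, φ i x * g x ∂μ) l (𝓝 (g x₀)) := by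
  have hsub : Tendsto (fun x => x₀ - x) (𝓝 x₀) (𝓝 0) :=
    (continuous_const.sub continuous_id).tendsto' _ _ (sub_self x₀)
  have hsupport :
      Tendsto (fun i => Function.support fun x => φ i (x₀ - x)) l (𝓝 0).smallSets := by
    refine tendsto_smallSets_iff.2 fun t ht => ?_
    filter_upwards [tendsto_smallSets_iff.1 hφs _ (hsub ht)] with i hi x hx
    simpa only [mem_preimage, sub_sub_cancel] using hi hx
  refine (convolution_tendsto_right (μ := μ) (g := fun _ => g)
    (hφ0.mono fun i hi x => hi (x₀ - x))
    (hφ1.mono fun i hi => by rwa [integral_sub_left_eq_self (φ i)]) hsupport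
    (.of_forall fun _ => hg.aestronglyMeasurable) ((hg.tendsto x₀).comp tendsto_snd)
    tendsto_const_nhds).congr fun i => ?_
  exact integral_sub_left_eq_self (fun x => φ i x * g x) μ x₀

end ApproximateIdentity

section Translation

variable {G : Type*} [AddCommGroup G] [TopologicalSpace G] [IsTopologicalAddGroup G]
  [MeasurableSpace G] [BorelSpace G] {μ : Measure G} [μ.IsAddLeftInvariant]
  [IsLocallyFiniteMeasure μ] [μ.InnerRegularCompactLTTop] {D U V : G → ℝ}

lemma tendsto_integral_abs_comp_sub_sub (hV : Integrable V μ) (h₀ : G) :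
    Tendsto (fun h => ∫ p, |V (p - h) - V (p - h₀)| ∂μ) (𝓝 h₀) (𝓝 0) := by
  have hV1 : MemLp V 1 μ := memLp_one_iff_integrable.2 hV
  let g : C(G, C(G, G)) := (ContinuousMap.mk (fun a : G × G => a.2 - a.1) (by fun_prop)).curry
  have hg (h) : MeasurePreserving (g h) μ μ := measurePreserving_sub_right μ h
  have hcont : Continuous fun h => Lp.compMeasurePreserving (g h) (hg h) (hV1.toLp V) :=
    continuous_const.compMeasurePreservingLp g.continuous hg ENNReal.one_ne_top
  refine (tendsto_iff_norm_sub_tendsto_zero.1 (hcont.tendsto h₀)).congr fun h => ?_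
  rw [Lp.toLp_compMeasurePreserving, Lp.toLp_compMeasurePreserving, ← MemLp.toLp_sub, Lp.norm_toLp,
    eLpNorm_one_eq_lintegral_enorm, ← integral_norm_eq_lintegral_enorm
      ((hV1.comp_measurePreserving (hg h)).1.sub (hV1.comp_measurePreserving (hg h₀)).1)]
  rfl

lemma continuous_integral_mul_abs_sub_comp_sub {B : ℝ} (hD : AEStronglyMeasurable D μ)
    (hDB : ∀ p, ‖D p‖ ≤ B) (hU : Integrable U μ) (hV : Integrable V μ) :
    Continuous fun h => ∫ p, D p * |U p - V (p - h)| ∂μ := by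
  have hint (h : G) : Integrable (fun p => D p * |U p - V (p - h)|) μ :=
    (hU.sub (hV.comp_sub_right h)).abs.bdd_mul hD (ae_of_all _ hDB)
  refine continuous_iff_continuousAt.2 fun h₀ => tendsto_iff_norm_sub_tendsto_zero.2 ?_
  refine squeeze_zero (fun _ => norm_nonneg _) (fun h => ?_)
    (((tendsto_integral_abs_comp_sub_sub hV h₀).const_mul B).trans_eq (by rw [mul_zero]))
  rw [← integral_sub (hint h) (hint h₀), ← integral_const_mul]
  refine norm_integral_le_of_norm_le
    (((hV.comp_sub_right h).sub (hV.comp_sub_right h₀)).abs.const_mul B) (ae_of_all _ fun p => ?_)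
  rw [← mul_sub, norm_mul]
  gcongr
  · exact (norm_nonneg _).trans (hDB p)
  · exact hDB p
  · rw [abs_sub_comm (V _)]
    simpa only [sub_sub_sub_cancel_left, Real.norm_eq_abs] using
      abs_abs_sub_abs_le (U p - V (p - h)) (U p - V (p - h₀))

end Translation

lemma integral_mul_comp_sub {G : Type*} [AddCommGroup G] [MeasurableSpace G] [MeasurableAdd₂ G]
    [MeasurableNeg G] {μ : Measure G} [SFinite μ] [μ.IsAddLeftInvariant] {Φ : G × G → ℝ}
    {ρ : G → ℝ} (hint : Integrable (fun a => Φ a * ρ (a.1 - a.2)) (μ.prod μ)) :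
    ∫ a, Φ a * ρ (a.1 - a.2) ∂(μ.prod μ) = ∫ h, ρ h * ∫ p, Φ (p, p - h) ∂μ ∂μ := by
  have hshear := measurePreserving_add_prod μ μ
  have hint' : Integrable (fun z : G × G => Φ (z.1 + z.2, z.2) * ρ (z.1 + z.2 - z.2))
      (μ.prod μ) := hshear.integrable_comp_of_integrable hint
  rw [← hshear.map_eq, integral_map hshear.measurable.aemeasurable (hshear.map_eq.symm ▸ hint.1),
    integral_prod _ hint']
  refine integral_congr_ae (ae_of_all _ fun h => ?_)
  simp only [add_sub_cancel_right]
  rw [integral_mul_const, mul_comm,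
    ← integral_sub_right_eq_self (fun q => Φ (h + q, q)) h]
  simp only [add_sub_cancel]

section KatoInTime

variable {d : ℕ} {T : ℝ} {f : ℝ → Space d} {Lf : ℝ≥0} {A : ℝ → ℝ} {LA : ℝ≥0}
  {U V : SpaceTime d → ℝ} {Θ : ℝ → ℝ}

theorem IsLevyEntropySolution.integral_deriv_mul_abs_sub_nonneg {ν : Measure (Space d)}
    [SFinite ν] [ν.IsNegInvariant] (hν : IsLevyMeasure ν) (hf : LipschitzWith Lf f)
    (hA : LipschitzWith LA A) (hAmono : Monotone A) (hU : IsLevyEntropySolution ν T f A U)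
    (hV : IsLevyEntropySolution ν T f A V) (hΘ : ContDiff ℝ ∞ Θ) (hΘc : HasCompactSupport Θ)
    (hΘ0 : ∀ t, 0 ≤ Θ t) (hΘs : tsupport Θ ⊆ Ioo 0 T) :
    0 ≤ ∫ p, deriv Θ p.2 * |U p - V p| := by
  have hΘ' : Continuous (deriv Θ) := hΘ.continuous_deriv (by simp)
  obtain ⟨B, hB⟩ := hΘc.deriv.exists_bound_of_continuous hΘ'
  obtain ⟨δ, hδ, hδT⟩ := hΘc.isCompact.exists_cthickening_subset_open isOpen_Ioo hΘs
  let bump (n : ℕ) : ContDiffBump (0 : SpaceTime d) :=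
    ⟨δ / (n + 2), δ / (n + 1), by positivity, by gcongr; norm_num⟩
  have hbump (n : ℕ) : (bump n).rOut ≤ δ := div_le_self hδ.le (by simp)
  have hrOut : Tendsto (fun n => (bump n).rOut) atTop (𝓝 0) :=
    tendsto_const_div_atTop_nhds_zero_nat δ |>.comp (tendsto_add_atTop_nat 1) |>.congr fun n => by
      simp [bump]
  have hlim := tendsto_integral_mul_of_tendsto_support (μ := volume)
    (.of_forall fun n => (bump n).nonneg_normed) (.of_forall fun n => (bump n).integral_normed)
    (ContDiffBump.tendsto_support_normed_smallSets hrOut)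
    (continuous_integral_mul_abs_sub_comp_sub
      (hΘ'.comp continuous_snd).aestronglyMeasurable (fun p => hB p.2) hU.integrable hV.integrable)
  simp only [sub_zero] at hlim
  refine ge_of_tendsto' hlim fun n => ?_
  have hmollified := hU.integral_deriv_mul_mollified_nonneg hν hf hA hAmono hV
    (ρ := (bump n).normed volume) (bump n).contDiff_normed (bump n).hasCompactSupport_normed
    (bump n).nonneg_normed hΘ hΘc hΘ0 hΘs fun t ht h hh => ?_
  · have hint := (integrable_abs_sub_mul_comp_sub hU.integrable hV.integrable
      ((bump n).integrable_normed (μ := volume))).bdd_mul (c := B)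
      (hΘ'.comp (continuous_snd.comp continuous_fst)).aestronglyMeasurable
      (ae_of_all _ fun a => hB a.1.2)
    simp only [Function.comp_apply, ← mul_assoc] at hint hmollified
    exact hmollified.trans_eq
      (integral_mul_comp_sub (Φ := fun a => deriv Θ a.1.2 * |U a.1 - V a.2|) hint)
  · rw [(bump n).tsupport_normed_eq, mem_closedBall_zero_iff] at hh
    refine hδT (Metric.mem_cthickening_of_dist_le _ t _ _ ht ?_)
    rw [Real.dist_eq, sub_sub_cancel_left, abs_neg, ← Real.norm_eq_abs]
    exact (norm_snd_le h).trans (hh.trans (hbump n))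

end KatoInTime

section Time

/-- A smooth transition from `0` to `1` on `[τ, τ + δ]`. -/
def smoothStep (τ δ t : ℝ) : ℝ := Real.smoothTransition ((t - τ) / δ)

variable {τ δ : ℝ}

lemma contDiff_smoothStep (τ δ : ℝ) : ContDiff ℝ ∞ (smoothStep τ δ) :=
  Real.smoothTransition.contDiff.comp ((contDiff_id.sub contDiff_const).div_const δ)

lemma differentiable_smoothStep (τ δ : ℝ) : Differentiable ℝ (smoothStep τ δ) :=
  (contDiff_smoothStep τ δ).differentiable (by simp)

lemma smoothStep_eq_zero (hδ : 0 < δ) {t : ℝ} (ht : t ≤ τ) : smoothStep τ δ t = 0 :=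
  Real.smoothTransition.zero_of_nonpos (div_nonpos_of_nonpos_of_nonneg (by linarith) hδ.le)

lemma smoothStep_eq_one (hδ : 0 < δ) {t : ℝ} (ht : τ + δ ≤ t) : smoothStep τ δ t = 1 :=
  Real.smoothTransition.one_of_one_le ((one_le_div hδ).2 (by linarith))

lemma deriv_smoothStep_nonneg (hδ : 0 < δ) (t : ℝ) : 0 ≤ deriv (smoothStep τ δ) t :=
  Monotone.deriv_nonneg fun a b hab => Real.smoothTransition.monotone (by gcongr)

lemma support_deriv_smoothStep_subset (hδ : 0 < δ) :
    Function.support (deriv (smoothStep τ δ)) ⊆ Icc τ (τ + δ) := by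
  refine fun t ht => ⟨?_, ?_⟩ <;> by_contra! hlt <;> refine ht ?_
  · have : smoothStep τ δ =ᶠ[𝓝 t] fun _ => 0 := by
      filter_upwards [Iio_mem_nhds hlt] with s hs using smoothStep_eq_zero hδ hs.le
    rw [this.deriv_eq, deriv_const]
  · have : smoothStep τ δ =ᶠ[𝓝 t] fun _ => 1 := by
      filter_upwards [Ioi_mem_nhds hlt] with s hs using smoothStep_eq_one hδ hs.le
    rw [this.deriv_eq, deriv_const]

lemma integrable_deriv_smoothStep_mul (hδ : 0 < δ) {m : ℝ → ℝ} (hm : Continuous m) :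
    Integrable fun t => deriv (smoothStep τ δ) t * m t :=
  (((contDiff_smoothStep τ δ).continuous_deriv (by simp)).mul hm).integrable_of_hasCompactSupport
    (.mul_right (.of_support_subset_isCompact isCompact_Icc (support_deriv_smoothStep_subset hδ)))

lemma integral_deriv_smoothStep (hδ : 0 < δ) : ∫ t, deriv (smoothStep τ δ) t = 1 := by
  have hbot : Tendsto (smoothStep τ δ) atBot (𝓝 0) := tendsto_const_nhds.congr' <| by
    filter_upwards [eventually_le_atBot τ] with t ht using (smoothStep_eq_zero hδ ht).symm
  have htop : Tendsto (smoothStep τ δ) atTop (𝓝 1) := tendsto_const_nhds.congr' <| by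
    filter_upwards [eventually_ge_atTop (τ + δ)] with t ht using (smoothStep_eq_one hδ ht).symm
  simpa only [mul_one, sub_zero] using integral_of_hasDerivAt_of_tendsto
    (fun t => (differentiable_smoothStep τ δ t).hasDerivAt)
    (by simpa only [mul_one] using
      integrable_deriv_smoothStep_mul hδ (m := fun _ => 1) continuous_const) hbot htop

lemma tendsto_integral_deriv_smoothStep_mul (τ : ℝ) {m : ℝ → ℝ} (hm : Continuous m) :
    Tendsto (fun δ => ∫ t, deriv (smoothStep τ δ) t * m t) (𝓝[>] 0) (𝓝 (m τ)) := by
  have hpos : ∀ᶠ δ : ℝ in 𝓝[>] 0, 0 < δ := self_mem_nhdsWithin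
  have hendpoint : Tendsto (fun δ => τ + δ) (𝓝[>] 0) (𝓝 τ) :=
    ((continuous_const_add τ).tendsto' 0 τ (add_zero τ)).mono_left nhdsWithin_le_nhds
  have hIcc : Tendsto (fun δ => Icc τ (τ + δ)) (𝓝[>] 0) (𝓝 τ).smallSets :=
    tendsto_const_nhds.Icc hendpoint
  refine tendsto_integral_mul_of_tendsto_support
    (hpos.mono fun δ hδ => deriv_smoothStep_nonneg hδ)
    (hpos.mono fun δ hδ => integral_deriv_smoothStep hδ)
    (tendsto_smallSets_iff.2 fun s hs => ?_) hm
  filter_upwards [hpos, tendsto_smallSets_iff.1 hIcc s hs] with δ hδ hsub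
  exact (support_deriv_smoothStep_subset hδ).trans hsub

variable {a b : ℝ} {m : ℝ → ℝ}

lemma tsupport_smoothStep_sub_subset (hδ : 0 < δ) (hab : a ≤ b) :
    tsupport (smoothStep a δ - smoothStep b δ) ⊆ Icc a (b + δ) := by
  refine closure_minimal (fun t ht => ⟨?_, ?_⟩) isClosed_Icc <;> by_contra! hlt <;> refine ht ?_
  · rw [Pi.sub_apply, smoothStep_eq_zero hδ hlt.le, smoothStep_eq_zero hδ (hlt.le.trans hab),
      sub_self]
  · rw [Pi.sub_apply, smoothStep_eq_one hδ hlt.le,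
      smoothStep_eq_one hδ (by linarith : a + δ ≤ t), sub_self]

theorem antitoneOn_of_integral_deriv_mul_nonneg (hm : Continuous m)
    (h : ∀ Θ : ℝ → ℝ, ContDiff ℝ ∞ Θ → HasCompactSupport Θ → (∀ t, 0 ≤ Θ t) →
      tsupport Θ ⊆ Ioo a b → 0 ≤ ∫ t, deriv Θ t * m t) : AntitoneOn m (Ioo a b) := by
  intro s hs t ht hst
  refine le_of_tendsto_of_tendsto (tendsto_integral_deriv_smoothStep_mul t hm)
    (tendsto_integral_deriv_smoothStep_mul s hm) ?_
  filter_upwards [Ioo_mem_nhdsGT (sub_pos.2 ht.2)] with δ hδ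
  have hsupp := tsupport_smoothStep_sub_subset hδ.1 hst
  have htest := h (smoothStep s δ - smoothStep t δ)
    ((contDiff_smoothStep s δ).sub (contDiff_smoothStep t δ))
    (.of_support_subset_isCompact isCompact_Icc ((subset_tsupport _).trans hsupp))
    (fun r => sub_nonneg.2 (Real.smoothTransition.monotone (by have := hδ.1; gcongr)))
    (hsupp.trans (Icc_subset_Ioo hs.1 (by linarith [hδ.2])))
  simp only [deriv_sub (differentiable_smoothStep s δ _) (differentiable_smoothStep t δ _),
    sub_mul] at htest
  rwa [integral_sub (integrable_deriv_smoothStep_mul hδ.1 hm)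
    (integrable_deriv_smoothStep_mul hδ.1 hm), sub_nonneg] at htest

end Time

section Contraction

variable {d : ℕ} {T lam c : ℝ} {f : ℝ → Space d} {Lf : ℝ≥0} {A : ℝ → ℝ} {LA : ℝ≥0}
  {u₀ v₀ : Space d → ℝ} {u v : Space d → ℝ → ℝ}

/-- The `L¹` distance of `u(·,t)` and `v(·,t)`, extended continuously to all times `t ∈ ℝ` by its
values at `0` and `T`. -/
def l1Dist (hT : 0 ≤ T) (hu : MemCL1 T u) (hv : MemCL1 T v) : ℝ → ℝ :=
  IccExtend hT fun t => ‖hu.curve t - hv.curve t‖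

lemma continuous_l1Dist (hT : 0 ≤ T) (hu : MemCL1 T u) (hv : MemCL1 T v) :
    Continuous (l1Dist hT hu hv) :=
  (hu.continuous_curve.sub hv.continuous_curve).norm.Icc_extend'

lemma ofReal_l1Dist (hT : 0 ≤ T) (hu : MemCL1 T u) (hv : MemCL1 T v) {t : ℝ} (ht : t ∈ Icc 0 T) :
    ENNReal.ofReal (l1Dist hT hu hv t) = eLpNorm (fun x => u x t - v x t) 1 volume := by
  rw [l1Dist, IccExtend_of_mem hT _ ht, MemCL1.norm_curve_sub]
  exact ENNReal.ofReal_toReal ((hu.1 t ht).sub (hv.1 t ht)).2.ne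

lemma l1Dist_eq_integral (hT : 0 ≤ T) (hu : MemCL1 T u) (hv : MemCL1 T v) {t : ℝ}
    (ht : t ∈ Icc 0 T) : l1Dist hT hu hv t = ∫ x, |u x t - v x t| := by
  rw [l1Dist, IccExtend_of_mem hT _ ht, MemCL1.norm_curve_sub, eLpNorm_one_eq_lintegral_enorm]
  exact (integral_norm_eq_lintegral_enorm ((hu.1 t ht).1.sub (hv.1 t ht).1)).symm

lemma integral_mul_abs_sub_eq_integral_mul_l1Dist (hT : 0 ≤ T) (hu : MemCL1 T u) (hv : MemCL1 T v)
    {U V : SpaceTime d → ℝ} (hU : Integrable U) (hV : Integrable V)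
    (huU : ∀ᵐ p ∂(volume.restrict (cylinder d T)), u p.1 p.2 = U p)
    (hvV : ∀ᵐ p ∂(volume.restrict (cylinder d T)), v p.1 p.2 = V p)
    {w : ℝ → ℝ} (hw : Continuous w) (hwc : HasCompactSupport w) (hws : ∀ t ∉ Ioo 0 T, w t = 0) :
    ∫ p : SpaceTime d, w p.2 * |U p - V p| = ∫ t, w t * l1Dist hT hu hv t := by
  obtain ⟨B, hB⟩ := hwc.exists_bound_of_continuous hw
  have hint : Integrable (fun p : SpaceTime d => w p.2 * |U p - V p|) (volume.prod volume) :=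
    (hU.sub hV).abs.bdd_mul (hw.comp continuous_snd).aestronglyMeasurable
      (ae_of_all _ fun p => hB p.2)
  rw [Measure.volume_eq_prod, integral_prod_symm _ hint]
  refine integral_congr_ae ?_
  filter_upwards [(ae_restrict_iff' measurableSet_Ioo).1 (ae_ae_of_ae_cylinder huU),
    (ae_restrict_iff' measurableSet_Ioo).1 (ae_ae_of_ae_cylinder hvV)] with t hut hvt
  simp only [integral_const_mul]
  by_cases ht : t ∈ Ioo 0 T
  · rw [l1Dist_eq_integral hT hu hv (Ioo_subset_Icc_self ht)]
    congr 1
    refine integral_congr_ae ?_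
    filter_upwards [hut ht, hvt ht] with x hux hvx
    rw [hux, hvx]
  · rw [hws t ht, zero_mul, zero_mul]

theorem antitoneOn_l1Dist (hd : 0 < d) (hlam : lam ∈ Ioo (0 : ℝ) 2) (hc : 0 < c)
    (hT : 0 < T) (hf : LipschitzWith Lf f) (hA : LipschitzWith LA A) (hAmono : Monotone A)
    (hu : IsEntropySolution c lam T f A u₀ u) (hv : IsEntropySolution c lam T f A v₀ v) :
    AntitoneOn (l1Dist hT.le hu.memCL1 hv.memCL1) (Ioo 0 T) := by
  obtain ⟨U, hU, huU⟩ := hu.exists_isLevyEntropySolution hd hlam hc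
  obtain ⟨V, hV, hvV⟩ := hv.exists_isLevyEntropySolution hd hlam hc
  refine antitoneOn_of_integral_deriv_mul_nonneg (continuous_l1Dist hT.le hu.memCL1 hv.memCL1)
    fun Θ hΘ hΘc hΘ0 hΘs => ?_
  rw [← integral_mul_abs_sub_eq_integral_mul_l1Dist hT.le hu.memCL1 hv.memCL1 hU.integrable
    hV.integrable huU hvV (hΘ.continuous_deriv (by simp)) hΘc.deriv
    fun t ht => Function.notMem_support.1 fun h => ht (hΘs (support_deriv_subset h))]
  exact hU.integral_deriv_mul_abs_sub_nonneg (isLevyMeasure_fracLevyMeasure hd hlam hc) hf hA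
    hAmono hV hΘ hΘc hΘ0 hΘs

theorem eLpNorm_sub_le_initial (hd : 0 < d) (hlam : lam ∈ Ioo (0 : ℝ) 2) (hc : 0 < c)
    (hf : LipschitzWith Lf f) (hA : LipschitzWith LA A) (hAmono : Monotone A)
    (hu : IsEntropySolution c lam T f A u₀ u) (hv : IsEntropySolution c lam T f A v₀ v)
    {t : ℝ} (ht : t ∈ Ioo 0 T) :
    eLpNorm (fun x => u x t - v x t) 1 volume ≤ eLpNorm (fun x => u₀ x - v₀ x) 1 volume := by
  have hT : 0 < T := ht.1.trans ht.2
  have hinitial : eLpNorm (fun x => u x 0 - v x 0) 1 volume =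
      eLpNorm (fun x => u₀ x - v₀ x) 1 volume :=
    eLpNorm_congr_ae (by filter_upwards [hu.initial, hv.initial] with x hux hvx; rw [hux, hvx])
  rw [← hinitial, ← ofReal_l1Dist hT.le hu.memCL1 hv.memCL1 (Ioo_subset_Icc_self ht),
    ← ofReal_l1Dist hT.le hu.memCL1 hv.memCL1 (left_mem_Icc.2 hT.le)]
  have hlim : Tendsto (l1Dist hT.le hu.memCL1 hv.memCL1) (𝓝[>] 0) (𝓝 _) :=
    ((continuous_l1Dist hT.le hu.memCL1 hv.memCL1).tendsto 0).mono_left nhdsWithin_le_nhds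
  refine ENNReal.ofReal_le_ofReal (ge_of_tendsto hlim ?_)
  filter_upwards [Ioo_mem_nhdsGT ht.1] with s hs
  exact antitoneOn_l1Dist hd hlam hc hT hf hA hAmono hu hv ⟨hs.1, hs.2.trans ht.2⟩ ht hs.2.le

theorem ae_eq_of_same_initial (hd : 0 < d) (hlam : lam ∈ Ioo (0 : ℝ) 2) (hc : 0 < c)
    (hT : 0 < T) (hf : LipschitzWith Lf f) (hA : LipschitzWith LA A) (hAmono : Monotone A)
    (hu : IsEntropySolution c lam T f A u₀ u) (hv : IsEntropySolution c lam T f A u₀ v)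
    {t : ℝ} (ht : t ∈ Icc 0 T) : ∀ᵐ x, u x t = v x t := by
  have hIoo : EqOn (fun s => ENNReal.ofReal (l1Dist hT.le hu.memCL1 hv.memCL1 s)) 0 (Ioo 0 T) := by
    intro s hs
    simpa [ofReal_l1Dist hT.le hu.memCL1 hv.memCL1 (Ioo_subset_Icc_self hs)] using
      eLpNorm_sub_le_initial hd hlam hc hf hA hAmono hu hv hs
  have hzero : ENNReal.ofReal (l1Dist hT.le hu.memCL1 hv.memCL1 t) = 0 := hIoo.closure
    (ENNReal.continuous_ofReal.comp (continuous_l1Dist hT.le hu.memCL1 hv.memCL1))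
    continuous_const (closure_Ioo hT.ne ▸ ht)
  rw [ofReal_l1Dist hT.le hu.memCL1 hv.memCL1 ht] at hzero
  filter_upwards [(eLpNorm_eq_zero_iff ((hu.memCL1.1 t ht).1.sub (hv.memCL1.1 t ht).1)
    one_ne_zero).1 hzero] with x hx
  exact sub_eq_zero.1 hx

theorem ae_cylinder_eq_of_same_initial (hd : 0 < d) (hlam : lam ∈ Ioo (0 : ℝ) 2) (hc : 0 < c)
    (hT : 0 < T) (hf : LipschitzWith Lf f) (hA : LipschitzWith LA A) (hAmono : Monotone A)
    (hu : IsEntropySolution c lam T f A u₀ u) (hv : IsEntropySolution c lam T f A u₀ v) :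
    ∀ᵐ p ∂(volume.restrict (cylinder d T)), u p.1 p.2 = v p.1 p.2 := by
  obtain ⟨U, hU, huU⟩ := hu.exists_isLevyEntropySolution hd hlam hc
  obtain ⟨V, hV, hvV⟩ := hv.exists_isLevyEntropySolution hd hlam hc
  have hUV : ∀ᵐ p ∂(volume.restrict (cylinder d T)), U p = V p := by
    have hms : MeasurableSet {p : Space d × ℝ | U (p.1, p.2) = V (p.1, p.2)} :=
      measurableSet_eq_fun hU.measurable hV.measurable
    rw [restrict_cylinder]
    refine (Measure.ae_prod_mem_iff_ae_ae_mem hms).2 ((Measure.ae_ae_comm hms).2 ?_)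
    filter_upwards [ae_ae_of_ae_cylinder huU, ae_ae_of_ae_cylinder hvV,
      ae_restrict_mem measurableSet_Ioo] with t hut hvt ht
    filter_upwards [hut, hvt, ae_eq_of_same_initial hd hlam hc hT hf hA hAmono hu hv
      (Ioo_subset_Icc_self ht)] with x hux hvx huv
    rw [← hux, ← hvx, huv]
  filter_upwards [huU, hvV, hUV] with p hup hvp hp
  rw [hup, hvp, hp]

end Contraction

end FracConvDiff

end

theorem mainTheorem1 {d : ℕ} (hd : 0 < d) (T : ℝ) (hT : 0 < T)
    (lam : ℝ) (hlam : lam ∈ Set.Ioo (0 : ℝ) 2) (c : ℝ) (hc : 0 < c)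
    (f : ℝ → FracConvDiff.Space d) (Lf : ℝ≥0) (hf : LipschitzWith Lf f)
    (A : ℝ → ℝ) (LA : ℝ≥0) (hA : LipschitzWith LA A) (hAmono : Monotone A) (hA0 : A 0 = 0) :
    (∀ (u₀ v₀ : FracConvDiff.Space d → ℝ) (u v : FracConvDiff.Space d → ℝ → ℝ),
      FracConvDiff.IsEntropySolution c lam T f A u₀ u →
      FracConvDiff.IsEntropySolution c lam T f A v₀ v →
      ∀ t ∈ Set.Ioo 0 T,
        eLpNorm (fun x => u x t - v x t) 1 volume ≤ eLpNorm (fun x => u₀ x - v₀ x) 1 volume) ∧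
    (∀ (u₀ : FracConvDiff.Space d → ℝ) (u v : FracConvDiff.Space d → ℝ → ℝ),
      FracConvDiff.IsEntropySolution c lam T f A u₀ u →
      FracConvDiff.IsEntropySolution c lam T f A u₀ v →
      (∀ᵐ p ∂(volume.restrict (FracConvDiff.cylinder d T)), u p.1 p.2 = v p.1 p.2) ∧
      ∀ t ∈ Set.Icc 0 T, ∀ᵐ x, u x t = v x t) := by
  refine ⟨fun u₀ v₀ u v hu hv t ht => ?_, fun u₀ u v hu hv => ⟨?_, fun t ht => ?_⟩⟩
  · exact FracConvDiff.eLpNorm_sub_le_initial hd hlam hc hf hA hAmono hu hv ht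
  · exact FracConvDiff.ae_cylinder_eq_of_same_initial hd hlam hc hT hf hA hAmono hu hv
  · exact FracConvDiff.ae_eq_of_same_initial hd hlam hc hT hf hA hAmono hu hv ht
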